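/- **Setting.** Consider the stochastic frontier model \[ Y_i = g(X_i,\beta_0)+V_i-U_i,\qquad i=1,2,\dots, \] with $X_i\in\mathbb R^p$, $\beta_0\in\mathbb R^q$, $U_i\ge 0$, where $g(\cdot,\beta)$ is measurable for every $\beta$. The triples $(X_i,V_i,U_i)$ are independent over $i$; for each $i$ the variables $X_i,V_i,U_i$ are mutually independent and have Lebesgue densities $f_X,f_V,f_U$ (the same for all $i$). The true conditional density of $Y$ given $X=x$ is $f(y|x)=\int_0^\infty f_U(u)f_V(u+y-g(x,\beta_0))\,du$. Let $\Theta$ be a set of parameters $\theta=(\beta,\eta)\in\mathbb R^q\times\mathbb R^k$ and, for $\theta\in\Theta$, let $\psi_{V,\eta}$ and $\psi_{U,\eta}$ be probability densities on $\mathbb R$, with $\psi_{U,\eta}(u)=0$ for $u<0$ (the pseudo densities of $V$ and $U$; for instance $N(0,\sigma_v^2)$ together with a truncated normal $N^+(\mu,\sigma_u^2)$ or an exponential law with mean $\sigma_u$, where $\sigma_u,\sigma_v$ are bounded away from $0$ on $\Theta$). They need not contain $f_V,f_U$. The pseudo conditional density is $f_\theta(y|x)=\int_0^\infty\psi_{U,\eta}(u)\psi_{V,\eta}(u+y-g(x,\beta))\,du$.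 Fix $\alpha>0$ and put \[ d_\alpha(h,f)=\int\Big\{f^{1+\alpha}(y)-\Big(1+\frac1\alpha\Big)h(y)f^\alpha(y)+\frac1\alpha h^{1+\alpha}(y)\Big\}dy\in[0,\infty], \] \[ H_\alpha(x,y;\theta)=\int f_\theta^{1+\alpha}(z|x)\,dz-\Big(1+\frac1\alpha\Big)f_\theta^\alpha(y|x). \] Write $(X,Y)=(X_1,Y_1)$ and let $\|\cdot\|$ be the $\ell_1$ norm of matrices. **Assumptions.** * **A1.** $\Theta$ is compact, and $\theta\mapsto E[d_\alpha(f(\cdot|X),f_\theta(\cdot|X))]$ has a unique minimizer $\theta^*_\alpha$ over $\Theta$. * **A2.** The $X_i$ are i.i.d. with density $f_X$ and independent of the $V_i$ and $U_i$ (as above). * **A3.** $g(x,\beta)$ is continuous in $\beta$ for every $x\in\mathbb R^p$. * **A4.** There is a constant $C$ with $f_\theta(y|x)\le C$ for all $\theta\in\Theta$ and all $x,y$. * **A5.** $\theta^*_\alpha$ lies in the interior of $\Theta$. Moreover, for almost every value $(x,y)$ of $(X,Y)$, the function $H_\alpha(x,y;\cdot)$ is twice differentiable at every point of $\Theta$,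 and * **A6.** all entries of $K_\alpha:=E[\partial_\theta H_\alpha(X,Y;\theta^*_\alpha)\,\partial_{\theta^T}H_\alpha(X,Y;\theta^*_\alpha)]$ are finite (the products are integrable); * **A7.** $\sup_{\theta\in\Theta}\|\partial^2_{\theta\theta^T}H_\alpha(X,Y;\theta)\|$ is measurable with finite expectation; * **A8.** $J_\alpha:=E[\partial^2_{\theta\theta^T}H_\alpha(X,Y;\theta^*_\alpha)]$ is positive definite. **Theorem 2.** Let $\hat\theta_{\alpha,n}$, $n\ge1$, be random vectors such that almost surely $\hat\theta_{\alpha,n}$ minimizes $\frac1n\sum_{i=1}^nH_\alpha(X_i,Y_i;\theta)$ over $\theta\in\Theta$. Under these assumptions \[ \sqrt n\,(\hat\theta_{\alpha,n}-\theta^*_\alpha)\ \xrightarrow{\ d\ }\ N\big(0,\;J_\alpha^{-1}K_\alpha J_\alpha^{-1}\big)\qquad(n\to\infty). \] -/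

import Mathlib

open MeasureTheory ProbabilityTheory Filter Topology
open scoped ENNReal

noncomputable section

/-- `f` is a probability density with respect to Lebesgue measure. -/
structure IsProbDensity {E : Type*} [MeasureSpace E] (f : E → ℝ) : Prop where
  measurable : Measurable f
  nonneg : ∀ x, 0 ≤ f x
  lintegral_eq_one : ∫⁻ x, ENNReal.ofReal (f x) = 1

/-- The random variable `Z` has the probability density `f` under `P`. -/
def HasDensity {Ω E : Type*} [MeasurableSpace Ω] [MeasureSpace E]
    (P : Measure Ω) (Z : Ω → E) (f : E → ℝ) : Prop :=
  Measurable Z ∧ IsProbDensity f ∧ P.map Z = volume.withDensity fun x => ENNReal.ofReal (f x)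

/-- The density at `y` of `m + V - U`, where `V` has density `fV`, `U ≥ 0` has density `fU`, and
`U`, `V` are independent: `∫_0^∞ fU(u) fV(u + y - m) du`. With `m = g(x, β)` this is the conditional
density of the output `y` given the input `x` in the stochastic frontier model. -/
def frontierDensity (fV fU : ℝ → ℝ) (m y : ℝ) : ℝ :=
  ∫ u in Set.Ioi (0 : ℝ), fU u * fV (u + y - m)

/-- A random sample `(X i, Y i)`, `i = 0, 1, 2, …`, of the stochastic frontier model
`Y i = g (X i, β) + V i - U i`. The triples `(X i, V i, U i)` are independent over `i`, the three
components are mutually independent, and they have densities `fX`, `fV`, `fU` (the same for all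
`i`), where the inefficiency `U i` is nonnegative. -/
structure IsFrontierSample {Ω : Type*} [MeasurableSpace Ω] (P : Measure Ω) {p q : ℕ}
    (g : EuclideanSpace ℝ (Fin p) → EuclideanSpace ℝ (Fin q) → ℝ)
    (β : EuclideanSpace ℝ (Fin q))
    (fX : EuclideanSpace ℝ (Fin p) → ℝ) (fV fU : ℝ → ℝ)
    (X : ℕ → Ω → EuclideanSpace ℝ (Fin p)) (V U Y : ℕ → Ω → ℝ) : Prop where
  model : ∀ i ω, Y i ω = g (X i ω) β + V i ω - U i ω
  density_X : ∀ i, HasDensity P (X i) fX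
  density_V : ∀ i, HasDensity P (V i) fV
  density_U : ∀ i, HasDensity P (U i) fU
  fU_support : ∀ u < 0, fU u = 0
  indep : iIndepFun (fun i ω => (X i ω, V i ω, U i ω)) P
  indep_X : ∀ i, IndepFun (X i) (fun ω => (V i ω, U i ω)) P
  indep_V_U : ∀ i, IndepFun (V i) (U i) P

/-- The space of parameters `θ = (β, η)`, where `β ∈ ℝ^q` is the parameter of the frontier function
and `η ∈ ℝ^k` is the parameter of the pseudo distributions of `V` and `U`. -/
abbrev ParamSpace (q k : ℕ) : Type := EuclideanSpace ℝ (Fin q ⊕ Fin k)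

/-- The component `β` of `θ = (β, η)`. -/
def ParamSpace.beta {q k : ℕ} (θ : ParamSpace q k) : EuclideanSpace ℝ (Fin q) :=
  WithLp.toLp 2 fun i => θ (Sum.inl i)

/-- The component `η` of `θ = (β, η)`. -/
def ParamSpace.eta {q k : ℕ} (θ : ParamSpace q k) : EuclideanSpace ℝ (Fin k) :=
  WithLp.toLp 2 fun i => θ (Sum.inr i)

/-- The pseudo conditional density `f_θ(y|x)`, `θ = (β, η)`, induced from the pseudo densities
`ψV η` of `V` and `ψU η` of `U`. -/
def pseudoDensity {p q k : ℕ} (g : EuclideanSpace ℝ (Fin p) → EuclideanSpace ℝ (Fin q) → ℝ)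
    (ψV ψU : EuclideanSpace ℝ (Fin k) → ℝ → ℝ) (θ : ParamSpace q k)
    (x : EuclideanSpace ℝ (Fin p)) (y : ℝ) : ℝ :=
  frontierDensity (ψV θ.eta) (ψU θ.eta) (g x θ.beta) y

/-- The density power divergence `d_α(g, f)`, `α > 0`, of two densities on `ℝ`. The integrand is
pointwise nonnegative, so that the divergence is an element of `[0, ∞]`. -/
def densityPowerDivergence (α : ℝ) (g f : ℝ → ℝ) : ℝ≥0∞ :=
  ∫⁻ y, ENNReal.ofReal
    (f y ^ (1 + α) - (1 + 1 / α) * (g y * f y ^ α) + 1 / α * g y ^ (1 + α))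

/-- The objective `H_α(x, y; θ) = ∫ f_θ(z|x)^(1+α) dz - (1 + 1/α) f_θ(y|x)^α`, `α > 0`, as a
function of `θ`, for a family `f` of conditional densities. -/
def objective {T E : Type*} (α : ℝ) (f : T → E → ℝ → ℝ) (x : E) (y : ℝ) (θ : T) : ℝ :=
  (∫ z, f θ x z ^ (1 + α)) - (1 + 1 / α) * f θ x y ^ α

/-- `θ` is the unique minimizer of `F` over `S`. -/
def IsUniqueMinimizer {T R : Type*} [LT R] (F : T → R) (S : Set T) (θ : T) : Prop :=
  θ ∈ S ∧ ∀ t ∈ S, t ≠ θ → F θ < F t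

/-- `F` is twice differentiable at `θ`: it is differentiable near `θ`, and its derivative is
differentiable at `θ`. -/
def TwiceDifferentiableAt {ι : Type*} [Fintype ι] (F : EuclideanSpace ℝ ι → ℝ)
    (θ : EuclideanSpace ℝ ι) : Prop :=
  (∀ᶠ t in 𝓝 θ, DifferentiableAt ℝ F t) ∧ DifferentiableAt ℝ (fderiv ℝ F) θ

/-- The partial derivative `∂F/∂θ_i`. -/
def partialDeriv {ι : Type*} [Fintype ι] [DecidableEq ι] (i : ι) (F : EuclideanSpace ℝ ι → ℝ)
    (θ : EuclideanSpace ℝ ι) : ℝ :=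
  fderiv ℝ F θ (EuclideanSpace.single i 1)

/-- The Hessian matrix `∂²F/∂θ∂θᵀ`. -/
def hessianMatrix {ι : Type*} [Fintype ι] [DecidableEq ι] (F : EuclideanSpace ℝ ι → ℝ)
    (θ : EuclideanSpace ℝ ι) : Matrix ι ι ℝ :=
  Matrix.of fun i j => partialDeriv i (partialDeriv j F) θ

/-- The `ℓ¹` norm of a matrix: the sum of the absolute values of its entries. -/
def matrixL1Norm {ι : Type*} [Fintype ι] (A : Matrix ι ι ℝ) : ℝ := ∑ i, ∑ j, |A i j|

/-- The expected Hessian `J = E[∂²F/∂θ∂θᵀ(θ)]` of a random function `F`. -/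
def expectedHessian {Ω ι : Type*} [MeasurableSpace Ω] [Fintype ι] [DecidableEq ι]
    (P : Measure Ω) (F : Ω → EuclideanSpace ℝ ι → ℝ) (θ : EuclideanSpace ℝ ι) : Matrix ι ι ℝ :=
  Matrix.of fun i j => ∫ ω, hessianMatrix (F ω) θ i j ∂P

/-- The expected outer product `K = E[∂F/∂θ(θ) ∂F/∂θᵀ(θ)]` of the score of a random function. -/
def expectedScoreOuter {Ω ι : Type*} [MeasurableSpace Ω] [Fintype ι] [DecidableEq ι]
    (P : Measure Ω) (F : Ω → EuclideanSpace ℝ ι → ℝ) (θ : EuclideanSpace ℝ ι) : Matrix ι ι ℝ :=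
  Matrix.of fun i j => ∫ ω, partialDeriv i (F ω) θ * partialDeriv j (F ω) θ ∂P

end

/-! ### Densities of the frontier model -/

/-! The estimator minimizes an average of i.i.d. terms `H_α(X_i, Y_i; θ)`, so the result is
asymptotic normality of an M-estimator; the frontier model enters only through identification and
boundedness.

Identification. Conditioning on `X` turns the expected divergence into the expected objective plus a
term that does not depend on `θ`. That term may be infinite a priori, but a strict inequality
between two expected divergences forces it to be finite, so `θs` also uniquely minimizes `E[H_α]`
(`integral_objective_lt`). The bound `C` on the pseudo densities makes `H_α` uniformly bounded
(`abs_objective_le`).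

Consistency (`ae_tendsto_of_minimizer`) is Wald's argument: away from `θs`, finitely many local
infima of the contrast have expectation above the minimum, and the strong law applies to each.

Normality (`tendstoInDistribution_minimizer`). The Hessian need not be continuous in `θ`, so the
usual expansion with a Hessian at intermediate points is avoided. Instead the gradient is expanded
at `θs` itself. Its relative linearization error, maximized over a small ball, tends to 0 pointwise
by differentiability at `θs` and is dominated by twice the Hessian bound; hence its expectation is
small, and the strong law makes the averaged error `o(θhat - θs)` almost surely
(`ae_average_linearizationError_isLittleO`). The first order condition and the strong law for the
Hessian at `θs` then give `n⁻¹ ∑ ξ_i = (θhat - θs) + o(θhat - θs)` with `ξ = -J⁻¹ ∇H(θs)`.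
Asymptotic equivalence is symmetric, so the error is also `o(n⁻¹ ∑ ξ_i)`, and no separate proof of a
`√n` rate is needed: a Slutsky argument (`of_sub_isLittleO`) transfers the central limit theorem for
`ξ_i` to the estimator. The `ξ_i` are centered because `θs` is an interior minimum of the expected
contrast, and their covariance is `J⁻¹ K J⁻¹`. -/

lemma frontierDensity_nonneg {fV fU : ℝ → ℝ} (hV : ∀ v, 0 ≤ fV v) (hU : ∀ u, 0 ≤ fU u) (m y : ℝ) :
    0 ≤ frontierDensity fV fU m y :=
  integral_nonneg fun u => mul_nonneg (hU u) (hV _)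

lemma measurable_frontierDensity {fV fU : ℝ → ℝ} (hV : Measurable fV) (hU : Measurable fU) :
    Measurable fun z : ℝ × ℝ => frontierDensity fV fU z.1 z.2 := by
  refine (StronglyMeasurable.integral_prod_right
    (f := fun (z : ℝ × ℝ) (u : ℝ) => fU u * fV (u + z.2 - z.1)) ?_).measurable
  apply Measurable.stronglyMeasurable
  simp only [Function.uncurry_def]
  fun_prop

/-- Tonelli, followed for fixed `u` by the translation `v = u + y - m`. -/
lemma lintegral_lintegral_frontier {fV fU : ℝ → ℝ} (hV : Measurable fV) (hU : Measurable fU)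
    (hU0 : ∀ u, 0 ≤ fU u) (m : ℝ) {ψ : ℝ → ℝ≥0∞} (hψ : Measurable ψ) :
    ∫⁻ y, (∫⁻ u in Set.Ioi 0, ENNReal.ofReal (fU u * fV (u + y - m))) * ψ y =
      ∫⁻ u in Set.Ioi 0, ENNReal.ofReal (fU u) *
        ∫⁻ v, ENNReal.ofReal (fV v) * ψ (m + v - u) := by
  have h1 : ∀ y, (∫⁻ u in Set.Ioi 0, ENNReal.ofReal (fU u * fV (u + y - m))) * ψ y =
      ∫⁻ u in Set.Ioi 0, ENNReal.ofReal (fU u * fV (u + y - m)) * ψ y := fun y => by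
    rw [lintegral_mul_const]
    fun_prop
  simp_rw [h1]
  rw [lintegral_lintegral_swap (by fun_prop)]
  refine lintegral_congr fun u => ?_
  rw [← lintegral_const_mul _ (by fun_prop), ← lintegral_add_right_eq_self _ (m - u)]
  refine lintegral_congr fun v => ?_
  rw [ENNReal.ofReal_mul (hU0 u), mul_assoc]
  rw [show u + (v + (m - u)) - m = v by ring, show v + (m - u) = m + v - u by ring]

/-- The Bochner integral has the default value 0 where the integrand is not integrable. The total
mass is finite, so this can happen only for a null set of `y`. -/
lemma ae_ofReal_frontierDensity {fV fU : ℝ → ℝ} (hV : IsProbDensity fV) (hU : IsProbDensity fU)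
    (m : ℝ) : ∀ᵐ y, ENNReal.ofReal (frontierDensity fV fU m y) =
      ∫⁻ u in Set.Ioi 0, ENNReal.ofReal (fU u * fV (u + y - m)) := by
  have hVm := hV.measurable
  have hUm := hU.measurable
  have key := lintegral_lintegral_frontier hVm hUm hU.nonneg m (ψ := fun _ => 1) measurable_const
  simp only [mul_one, hV.lintegral_eq_one] at key
  have hfin : ∫⁻ y, (∫⁻ u in Set.Ioi 0, ENNReal.ofReal (fU u * fV (u + y - m))) ≠ ∞ := by
    rw [key]
    exact ((setLIntegral_le_lintegral _ _).trans_lt (by simp [hU.lintegral_eq_one])).ne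
  have hmeas : Measurable fun y => ∫⁻ u in Set.Ioi 0, ENNReal.ofReal (fU u * fV (u + y - m)) :=
    Measurable.lintegral_prod_right' (f := fun z : ℝ × ℝ =>
      ENNReal.ofReal (fU z.2 * fV (z.2 + z.1 - m))) (by fun_prop)
  filter_upwards [ae_lt_top hmeas hfin] with y hy
  have hnn : 0 ≤ᵐ[volume.restrict (Set.Ioi 0)] fun u => fU u * fV (u + y - m) :=
    Eventually.of_forall fun u => mul_nonneg (hU.nonneg u) (hV.nonneg _)
  refine ofReal_integral_eq_lintegral_ofReal ⟨?_, ?_⟩ hnn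
  · exact (Measurable.aestronglyMeasurable (by fun_prop))
  · rwa [hasFiniteIntegral_iff_ofReal hnn]

lemma lintegral_frontierDensity_mul {fV fU : ℝ → ℝ} (hV : IsProbDensity fV)
    (hU : IsProbDensity fU) (m : ℝ) {ψ : ℝ → ℝ≥0∞} (hψ : Measurable ψ) :
    ∫⁻ y, ENNReal.ofReal (frontierDensity fV fU m y) * ψ y =
      ∫⁻ u in Set.Ioi 0, ENNReal.ofReal (fU u) *
        ∫⁻ v, ENNReal.ofReal (fV v) * ψ (m + v - u) := by
  rw [← lintegral_lintegral_frontier hV.measurable hU.measurable hU.nonneg m hψ]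
  refine lintegral_congr_ae ?_
  filter_upwards [ae_ofReal_frontierDensity hV hU m] with y hy using by rw [hy]

lemma lintegral_frontierDensity_le_one {fV fU : ℝ → ℝ} (hV : IsProbDensity fV)
    (hU : IsProbDensity fU) (m : ℝ) :
    ∫⁻ y, ENNReal.ofReal (frontierDensity fV fU m y) ≤ 1 := by
  have := lintegral_frontierDensity_mul hV hU m (ψ := fun _ => 1) measurable_const
  simp only [mul_one, hV.lintegral_eq_one] at this
  rw [this]
  exact (setLIntegral_le_lintegral _ _).trans hU.lintegral_eq_one.le

/-- A bounded subprobability density is power integrable. -/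
lemma lintegral_rpow_le {f : ℝ → ℝ} {C α : ℝ} (hf0 : ∀ y, 0 ≤ f y) (hfC : ∀ y, f y ≤ C)
    (hα : 0 < α) (hf1 : ∫⁻ y, ENNReal.ofReal (f y) ≤ 1) :
    ∫⁻ y, ENNReal.ofReal (f y ^ (1 + α)) ≤ ENNReal.ofReal (C ^ α) := by
  have hC : 0 ≤ C := (hf0 0).trans (hfC 0)
  calc ∫⁻ y, ENNReal.ofReal (f y ^ (1 + α))
      ≤ ∫⁻ y, ENNReal.ofReal (C ^ α) * ENNReal.ofReal (f y) := by
        refine lintegral_mono fun y => ?_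
        rw [← ENNReal.ofReal_mul (by positivity)]
        refine ENNReal.ofReal_le_ofReal ?_
        rw [Real.rpow_add_of_nonneg (hf0 y) zero_le_one hα.le, Real.rpow_one, mul_comm]
        exact mul_le_mul_of_nonneg_right (Real.rpow_le_rpow (hf0 y) (hfC y) hα.le) (hf0 y)
    _ = ENNReal.ofReal (C ^ α) * ∫⁻ y, ENNReal.ofReal (f y) :=
        lintegral_const_mul' _ _ ENNReal.ofReal_ne_top
    _ ≤ ENNReal.ofReal (C ^ α) := mul_le_of_le_one_right' hf1

/-! ### Boundedness and measurability of the objective -/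

section Objective

variable {T 𝒳 : Type*} {f : T → 𝒳 → ℝ → ℝ} {θ : T} {C α : ℝ}

lemma abs_objective_le (hα : 0 < α) (hf0 : ∀ x y, 0 ≤ f θ x y) (hfC : ∀ x y, f θ x y ≤ C)
    (hf1 : ∀ x, ∫⁻ y, ENNReal.ofReal (f θ x y) ≤ 1) (x : 𝒳) (y : ℝ) :
    |objective α f x y θ| ≤ (2 + 1 / α) * C ^ α := by
  have h1 : 0 ≤ ∫ z, f θ x z ^ (1 + α) := integral_nonneg fun z => Real.rpow_nonneg (hf0 x z) _
  have hC : 0 ≤ C := (hf0 x 0).trans (hfC x 0)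
  have h2 : ∫ z, f θ x z ^ (1 + α) ≤ C ^ α := by
    have := lintegral_rpow_le (hf0 x) (hfC x) hα (hf1 x)
    refine (Real.le_norm_self _).trans ((norm_integral_le_lintegral_norm _).trans ?_)
    refine ENNReal.toReal_le_of_le_ofReal (by positivity) ?_
    simpa only [Real.norm_of_nonneg (Real.rpow_nonneg (hf0 x _) _)] using this
  have h3 : 0 ≤ f θ x y ^ α := Real.rpow_nonneg (hf0 x y) _
  have h4 : f θ x y ^ α ≤ C ^ α := Real.rpow_le_rpow (hf0 x y) (hfC x y) hα.le
  have h5 : 0 < 1 / α := by positivity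
  unfold objective
  rw [abs_le]
  constructor <;> nlinarith

lemma measurable_objective [MeasurableSpace 𝒳]
    (hf : Measurable fun z : 𝒳 × ℝ => f θ z.1 z.2) :
    Measurable fun z : 𝒳 × ℝ => objective α f z.1 z.2 θ := by
  unfold objective
  refine Measurable.sub ?_ ((hf.pow_const _).const_mul _)
  have : StronglyMeasurable fun x : 𝒳 => ∫ z, f θ x z ^ (1 + α) :=
    StronglyMeasurable.integral_prod_right (f := fun x z => f θ x z ^ (1 + α))
      (hf.pow_const _).stronglyMeasurable
  exact this.measurable.comp measurable_fst

end Objective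

lemma measurable_frontierDensity_comp {𝒳 : Type*} [MeasurableSpace 𝒳] {fV fU : ℝ → ℝ}
    (hV : Measurable fV) (hU : Measurable fU) {m : 𝒳 → ℝ} (hm : Measurable m) :
    Measurable fun z : 𝒳 × ℝ => frontierDensity fV fU (m z.1) z.2 :=
  (measurable_frontierDensity hV hU).comp (f := fun z : 𝒳 × ℝ => (m z.1, z.2)) (by fun_prop)

/-! ### The density power divergence -/

/-- Young's inequality for `a` and `b ^ α` with conjugate exponents `1 + α` and `(1 + α) / α`,
multiplied by `1 + 1 / α`. It makes the integrand of the divergence nonnegative. -/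
lemma one_add_one_div_mul_rpow_le {a b α : ℝ} (ha : 0 ≤ a) (hb : 0 ≤ b) (hα : 0 < α) :
    (1 + 1 / α) * (a * b ^ α) ≤ b ^ (1 + α) + 1 / α * a ^ (1 + α) := by
  have hpq : (1 + α).HolderConjugate ((1 + α) / α) := by
    rw [Real.holderConjugate_iff]
    refine ⟨by linarith, by field_simp⟩
  have key := Real.young_inequality_of_nonneg ha (Real.rpow_nonneg hb α) hpq
  rw [← Real.rpow_mul hb, mul_div_cancel₀ _ hα.ne'] at key
  calc (1 + 1 / α) * (a * b ^ α)
      ≤ (1 + 1 / α) * (a ^ (1 + α) / (1 + α) + b ^ (1 + α) / ((1 + α) / α)) :=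
        mul_le_mul_of_nonneg_left key (by positivity)
    _ = b ^ (1 + α) + 1 / α * a ^ (1 + α) := by field_simp; ring

/-- The negative term is moved to the other side, since every integral here may be infinite and
subtraction in `ℝ≥0∞` truncates. -/
lemma densityPowerDivergence_add {α : ℝ} (hα : 0 < α) {h f : ℝ → ℝ} (hh : Measurable h)
    (hf : Measurable f) (hh0 : ∀ y, 0 ≤ h y) (hf0 : ∀ y, 0 ≤ f y) :
    densityPowerDivergence α h f +
        ENNReal.ofReal (1 + 1 / α) * ∫⁻ y, ENNReal.ofReal (h y) * ENNReal.ofReal (f y ^ α) =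
      (∫⁻ y, ENNReal.ofReal (f y ^ (1 + α))) +
        ENNReal.ofReal (1 / α) * ∫⁻ y, ENNReal.ofReal (h y ^ (1 + α)) := by
  have hfα : Measurable fun y => f y ^ α := hf.pow_const _
  have hfα' : Measurable fun y => f y ^ (1 + α) := hf.pow_const _
  unfold densityPowerDivergence
  rw [← lintegral_const_mul' _ _ ENNReal.ofReal_ne_top,
    ← lintegral_const_mul' _ _ ENNReal.ofReal_ne_top, ← lintegral_add_right _ (by fun_prop),
    ← lintegral_add_left (by fun_prop)]
  refine lintegral_congr fun y => ?_
  have h1 := one_add_one_div_mul_rpow_le (hh0 y) (hf0 y) hα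
  have h2 := Real.rpow_nonneg (hf0 y) α
  have h3 := Real.rpow_nonneg (hf0 y) (1 + α)
  have h4 := Real.rpow_nonneg (hh0 y) (1 + α)
  have h5 := hh0 y
  rw [← ENNReal.ofReal_mul h5, ← ENNReal.ofReal_mul (by positivity),
    ← ENNReal.ofReal_mul (by positivity), ← ENNReal.ofReal_add (by linarith) (by positivity),
    ← ENNReal.ofReal_add h3 (by positivity)]
  congr 1
  ring

/-! ### The sample -/

section Sample

variable {Ω : Type*} [MeasurableSpace Ω] {P : Measure Ω} [IsProbabilityMeasure P] {p q : ℕ}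
  {g : EuclideanSpace ℝ (Fin p) → EuclideanSpace ℝ (Fin q) → ℝ}
  {β : EuclideanSpace ℝ (Fin q)} {fX : EuclideanSpace ℝ (Fin p) → ℝ} {fV fU : ℝ → ℝ}
  {X : ℕ → Ω → EuclideanSpace ℝ (Fin p)} {V U Y : ℕ → Ω → ℝ}

namespace IsFrontierSample

lemma map_triple (hs : IsFrontierSample P g β fX fV fU X V U Y) (i : ℕ) :
    P.map (fun ω => (X i ω, V i ω, U i ω)) =
      (P.map (X i)).prod ((P.map (V i)).prod (P.map (U i))) := by
  have hX := (hs.density_X i).1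
  have hV := (hs.density_V i).1
  have hU := (hs.density_U i).1
  rw [(indepFun_iff_map_prod_eq_prod_map_map hX.aemeasurable
    (hV.prodMk hU).aemeasurable).1 (hs.indep_X i),
    (indepFun_iff_map_prod_eq_prod_map_map hV.aemeasurable hU.aemeasurable).1 (hs.indep_V_U i)]

omit [IsProbabilityMeasure P] in
lemma eq_comp (hs : IsFrontierSample P g β fX fV fU X V U Y) (i : ℕ) :
    (fun ω => (X i ω, Y i ω)) = (fun z : EuclideanSpace ℝ (Fin p) × ℝ × ℝ =>
      (z.1, g z.1 β + z.2.1 - z.2.2)) ∘ fun ω => (X i ω, V i ω, U i ω) := by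
  ext ω <;> simp [hs.model i ω]

omit [IsProbabilityMeasure P] in
lemma measurable_pair (hs : IsFrontierSample P g β fX fV fU X V U Y)
    (hg : Measurable fun x => g x β) (i : ℕ) : Measurable fun ω => (X i ω, Y i ω) := by
  have hX := (hs.density_X i).1
  have hV := (hs.density_V i).1
  have hU := (hs.density_U i).1
  rw [hs.eq_comp i]
  fun_prop

omit [IsProbabilityMeasure P] in
lemma iIndepFun_pair (hs : IsFrontierSample P g β fX fV fU X V U Y)
    (hg : Measurable fun x => g x β) : iIndepFun (fun i ω => (X i ω, Y i ω)) P := by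
  have := hs.indep.comp (fun _ (z : EuclideanSpace ℝ (Fin p) × ℝ × ℝ) =>
      (z.1, g z.1 β + z.2.1 - z.2.2)) (fun i => by fun_prop)
  simpa only [← hs.eq_comp] using this

lemma identDistrib_pair (hs : IsFrontierSample P g β fX fV fU X V U Y)
    (hg : Measurable fun x => g x β) (i : ℕ) :
    IdentDistrib (fun ω => (X i ω, Y i ω)) (fun ω => (X 0 ω, Y 0 ω)) P P := by
  rw [hs.eq_comp i, hs.eq_comp 0]
  refine IdentDistrib.comp ?_ (by fun_prop)
  have h (j : ℕ) : Measurable fun ω => (X j ω, V j ω, U j ω) :=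
    (hs.density_X j).1.prodMk ((hs.density_V j).1.prodMk (hs.density_U j).1)
  refine ⟨(h i).aemeasurable, (h 0).aemeasurable, ?_⟩
  simp only [hs.map_triple, (hs.density_X _).2.2, (hs.density_V _).2.2, (hs.density_U _).2.2]

/-- The conditional density of `Y` given `X` is the frontier density. -/
lemma lintegral_pair (hs : IsFrontierSample P g β fX fV fU X V U Y)
    (hg : Measurable fun x => g x β) {ψ : EuclideanSpace ℝ (Fin p) × ℝ → ℝ≥0∞}
    (hψ : Measurable ψ) :
    ∫⁻ ω, ψ (X 0 ω, Y 0 ω) ∂P =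
      ∫⁻ ω, (∫⁻ y, ENNReal.ofReal (frontierDensity fV fU (g (X 0 ω) β) y) * ψ (X 0 ω, y)) ∂P := by
  obtain ⟨hX, -, -⟩ := hs.density_X 0
  obtain ⟨hV, hfV, hVm⟩ := hs.density_V 0
  obtain ⟨hU, hfU, hUm⟩ := hs.density_U 0
  have hfVm := hfV.measurable
  have hfUm := hfU.measurable
  have : IsProbabilityMeasure (P.map (X 0)) := Measure.isProbabilityMeasure_map hX.aemeasurable
  have : IsProbabilityMeasure (P.map (V 0)) := Measure.isProbabilityMeasure_map hV.aemeasurable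
  have : IsProbabilityMeasure (P.map (U 0)) := Measure.isProbabilityMeasure_map hU.aemeasurable
  have hm : Measurable fun ω => (X 0 ω, V 0 ω, U 0 ω) := by fun_prop
  have h1 : ∀ ω, ψ (X 0 ω, Y 0 ω) = (fun z : EuclideanSpace ℝ (Fin p) × ℝ × ℝ =>
      ψ (z.1, g z.1 β + z.2.1 - z.2.2)) (X 0 ω, V 0 ω, U 0 ω) := fun ω => by simp [hs.model 0 ω]
  have hmz : Measurable (fun z : EuclideanSpace ℝ (Fin p) × ℝ × ℝ =>
      ψ (z.1, g z.1 β + z.2.1 - z.2.2)) := by fun_prop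
  simp_rw [h1]
  rw [← lintegral_map (μ := P) hmz hm, hs.map_triple 0, lintegral_prod _ hmz.aemeasurable,
    lintegral_map (Measurable.lintegral_prod_right' hmz) hX]
  refine lintegral_congr fun ω => ?_
  have hmz' : Measurable fun z : ℝ × ℝ => ψ (X 0 ω, g (X 0 ω) β + z.1 - z.2) := by fun_prop
  rw [lintegral_prod_symm _ hmz'.aemeasurable,
    lintegral_frontierDensity_mul (ψ := fun y => ψ (X 0 ω, y)) hfV hfU _ (by fun_prop), hUm, hVm,
    lintegral_withDensity_eq_lintegral_mul _ (by fun_prop)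
      (Measurable.lintegral_prod_left' (μ := volume.withDensity _) hmz')]
  -- The law of `U` lives on all of `ℝ`, the frontier density integrates over `(0, ∞)` only: the
  -- density vanishes on the negatives, and the point 0 is null.
  have h0 : ∀ᵐ u : ℝ, u ∉ Set.Ioi (0 : ℝ) → ENNReal.ofReal (fU u) = 0 := by
    filter_upwards [Measure.ae_ne volume (0 : ℝ)] with u hu hu'
    rw [hs.fU_support u (lt_of_le_of_ne (not_lt.1 hu') hu), ENNReal.ofReal_zero]
  rw [← lintegral_indicator measurableSet_Ioi]
  refine lintegral_congr_ae ?_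
  filter_upwards [h0] with u hu
  rw [Pi.mul_apply]
  by_cases hu' : u ∈ Set.Ioi (0 : ℝ)
  · rw [Set.indicator_of_mem hu', lintegral_withDensity_eq_lintegral_mul _ (by fun_prop)
      (by fun_prop)]
    rfl
  · rw [Set.indicator_of_notMem hu', hu hu', zero_mul]

/-! ### From expected divergence to expected objective -/

section Identification

variable {T : Type*} {f : T → EuclideanSpace ℝ (Fin p) → ℝ → ℝ} {α C : ℝ}

/-- `densityPowerDivergence_add` integrated over `X`. Here `B` is the mean of `∫ f_θ(z|X)^(1+α) dz`
and `A` is `(1 + 1/α) E[f_θ(Y|X)^α]`, both finite by the bound `C`; the last term is free of `θ`. -/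
lemma integral_objective (hs : IsFrontierSample P g β fX fV fU X V U Y)
    (hg : Measurable fun x => g x β) (hα : 0 < α) {θ : T}
    (hfm : Measurable fun z : EuclideanSpace ℝ (Fin p) × ℝ => f θ z.1 z.2)
    (hf0 : ∀ x y, 0 ≤ f θ x y) (hfC : ∀ x y, f θ x y ≤ C)
    (hf1 : ∀ x, ∫⁻ y, ENNReal.ofReal (f θ x y) ≤ 1) :
    ∃ A B : ℝ, ∫ ω, objective α f (X 0 ω) (Y 0 ω) θ ∂P = B - A ∧ 0 ≤ A ∧ 0 ≤ B ∧
      (∫⁻ ω, densityPowerDivergence α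
        (frontierDensity fV fU (g (X 0 ω) β)) (f θ (X 0 ω)) ∂P) + ENNReal.ofReal A =
      ENNReal.ofReal B + ∫⁻ ω, ENNReal.ofReal (1 / α) *
        (∫⁻ y, ENNReal.ofReal (frontierDensity fV fU (g (X 0 ω) β) y ^ (1 + α))) ∂P := by
  have hX := (hs.density_X 0).1
  have hfV := (hs.density_V 0).2.1
  have hfU := (hs.density_U 0).2.1
  have hC : 0 ≤ C := (hf0 0 0).trans (hfC 0 0)
  have hXY := hs.measurable_pair hg 0
  have hφ := measurable_frontierDensity_comp hfV.measurable hfU.measurable hg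
  have hfα : Measurable fun z : EuclideanSpace ℝ (Fin p) × ℝ => f θ z.1 z.2 ^ α :=
    hfm.pow_const _
  have hfα' : Measurable fun z : EuclideanSpace ℝ (Fin p) × ℝ => f θ z.1 z.2 ^ (1 + α) :=
    hfm.pow_const _
  have hmA : Measurable fun ω => f θ (X 0 ω) (Y 0 ω) ^ α := hfα.comp hXY
  have hmB0 : StronglyMeasurable fun x => ∫ z, f θ x z ^ (1 + α) :=
    StronglyMeasurable.integral_prod_right (f := fun x z => f θ x z ^ (1 + α))
      hfα'.stronglyMeasurable
  have hmB : Measurable fun ω => ∫ z, f θ (X 0 ω) z ^ (1 + α) := hmB0.measurable.comp hX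
  have hrp (x) (y : ℝ) : 0 ≤ f θ x y ^ α := Real.rpow_nonneg (hf0 x y) _
  have hrp' (x) (y : ℝ) : 0 ≤ f θ x y ^ (1 + α) := Real.rpow_nonneg (hf0 x y) _
  have hB1 (x) : ENNReal.ofReal (∫ z, f θ x z ^ (1 + α)) =
      ∫⁻ z, ENNReal.ofReal (f θ x z ^ (1 + α)) := by
    refine ofReal_integral_eq_lintegral_ofReal ⟨?_, ?_⟩ (Eventually.of_forall (hrp' x))
    · exact (hfα'.comp measurable_prodMk_left).aestronglyMeasurable
    · rw [hasFiniteIntegral_iff_ofReal (Eventually.of_forall (hrp' x))]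
      exact (lintegral_rpow_le (hf0 x) (hfC x) hα (hf1 x)).trans_lt ENNReal.ofReal_lt_top
  have hB0 (x) : 0 ≤ ∫ z, f θ x z ^ (1 + α) := integral_nonneg (hrp' x)
  have hB2 (x) : ∫ z, f θ x z ^ (1 + α) ≤ C ^ α := by
    rw [← ENNReal.ofReal_le_ofReal_iff (by positivity), hB1 x]
    exact lintegral_rpow_le (hf0 x) (hfC x) hα (hf1 x)
  have hiA : Integrable (fun ω => f θ (X 0 ω) (Y 0 ω) ^ α) P :=
    Integrable.of_bound hmA.aestronglyMeasurable (C ^ α) (Eventually.of_forall fun ω => by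
      rw [Real.norm_of_nonneg (hrp _ _)]
      exact Real.rpow_le_rpow (hf0 _ _) (hfC _ _) hα.le)
  have hiB : Integrable (fun ω => ∫ z, f θ (X 0 ω) z ^ (1 + α)) P :=
    Integrable.of_bound hmB.aestronglyMeasurable (C ^ α) (Eventually.of_forall fun ω => by
      rw [Real.norm_of_nonneg (hB0 _)]
      exact hB2 _)
  refine ⟨(1 + 1 / α) * ∫ ω, f θ (X 0 ω) (Y 0 ω) ^ α ∂P, ∫ ω, (∫ z, f θ (X 0 ω) z ^ (1 + α)) ∂P,
    ?_, mul_nonneg (by positivity) (integral_nonneg fun ω => hrp _ _),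
    integral_nonneg fun ω => hB0 _, ?_⟩
  · simp only [objective]
    rw [integral_sub hiB (hiA.const_mul _), integral_const_mul]
  · rw [ENNReal.ofReal_mul (by positivity),
      ofReal_integral_eq_lintegral_ofReal hiA (Eventually.of_forall fun ω => hrp _ _),
      ofReal_integral_eq_lintegral_ofReal hiB (Eventually.of_forall fun ω => hB0 _),
      hs.lintegral_pair hg (ψ := fun z => ENNReal.ofReal (f θ z.1 z.2 ^ α)) (by fun_prop),
      ← lintegral_const_mul' _ _ ENNReal.ofReal_ne_top, ← lintegral_add_right _ ?_,
      ← lintegral_add_left (by fun_prop)]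
    · refine lintegral_congr fun ω => ?_
      rw [hB1]
      exact densityPowerDivergence_add hα (hφ.comp measurable_prodMk_left)
        (hfm.comp measurable_prodMk_left)
        (fun y => frontierDensity_nonneg hfV.nonneg hfU.nonneg _ _) (hf0 _)
    · refine Measurable.const_mul ?_ _
      refine Measurable.comp (g := fun x => ∫⁻ y, ENNReal.ofReal (frontierDensity fV fU (g x β) y) *
        ENNReal.ofReal (f θ x y ^ α)) ?_ hX
      exact Measurable.lintegral_prod_right' (f := fun z : EuclideanSpace ℝ (Fin p) × ℝ =>
        ENNReal.ofReal (frontierDensity fV fU (g z.1 β) z.2) * ENNReal.ofReal (f θ z.1 z.2 ^ α))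
        (by fun_prop)

/-- A smaller expected divergence means a smaller expected objective. -/
lemma integral_objective_lt (hs : IsFrontierSample P g β fX fV fU X V U Y)
    (hg : Measurable fun x => g x β) (hα : 0 < α) {s t : T}
    (hfm : ∀ θ ∈ ({s, t} : Set T),
      Measurable fun z : EuclideanSpace ℝ (Fin p) × ℝ => f θ z.1 z.2)
    (hf0 : ∀ θ ∈ ({s, t} : Set T), ∀ x y, 0 ≤ f θ x y)
    (hfC : ∀ θ ∈ ({s, t} : Set T), ∀ x y, f θ x y ≤ C)
    (hf1 : ∀ θ ∈ ({s, t} : Set T), ∀ x, ∫⁻ y, ENNReal.ofReal (f θ x y) ≤ 1)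
    (hlt : ∫⁻ ω, densityPowerDivergence α
        (frontierDensity fV fU (g (X 0 ω) β)) (f s (X 0 ω)) ∂P <
      ∫⁻ ω, densityPowerDivergence α
        (frontierDensity fV fU (g (X 0 ω) β)) (f t (X 0 ω)) ∂P) :
    ∫ ω, objective α f (X 0 ω) (Y 0 ω) s ∂P < ∫ ω, objective α f (X 0 ω) (Y 0 ω) t ∂P := by
  have hsm : s ∈ ({s, t} : Set T) := by simp
  have htm : t ∈ ({s, t} : Set T) := by simp
  obtain ⟨A, B, hAB, hA, hB, h1⟩ := hs.integral_objective (f := f) hg hα (hfm s hsm) (hf0 s hsm)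
    (hfC s hsm) (hf1 s hsm)
  obtain ⟨A', B', hAB', hA', hB', h2⟩ := hs.integral_objective (f := f) hg hα (hfm t htm)
    (hf0 t htm) (hfC t htm) (hf1 t htm)
  rw [hAB, hAB']
  have key : ENNReal.ofReal B + ENNReal.ofReal A' < ENNReal.ofReal B' + ENNReal.ofReal A := by
    -- The divergence at `s` lies strictly below another value, hence is finite; the identity for
    -- `s` then bounds the `θ`-free term, which can be cancelled.
    have hG : ∫⁻ ω, ENNReal.ofReal (1 / α) *
        (∫⁻ y, ENNReal.ofReal (frontierDensity fV fU (g (X 0 ω) β) y ^ (1 + α))) ∂P ≠ ∞ := by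
      refine ne_top_of_le_ne_top ?_ (le_add_self.trans h1.ge)
      exact ENNReal.add_ne_top.2 ⟨hlt.ne_top, ENNReal.ofReal_ne_top⟩
    refine lt_of_add_lt_add_right (a := ∫⁻ ω, ENNReal.ofReal (1 / α) *
        (∫⁻ y, ENNReal.ofReal (frontierDensity fV fU (g (X 0 ω) β) y ^ (1 + α))) ∂P) ?_
    rw [add_right_comm, ← h1, add_right_comm (ENNReal.ofReal B'), ← h2, add_assoc, add_assoc,
      add_comm (ENNReal.ofReal A)]
    exact ENNReal.add_lt_add_right (by simp) hlt
  rw [← ENNReal.ofReal_add hB hA', ← ENNReal.ofReal_add hB' hA,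
    ENNReal.ofReal_lt_ofReal_iff_of_nonneg (by positivity)] at key
  linarith

end Identification

end IsFrontierSample

end Sample

/-! ### The multivariate central limit theorem -/

section CentralLimit

variable {Ω ι : Type*} [MeasurableSpace Ω] {P : Measure Ω} [IsProbabilityMeasure P] [Fintype ι]

-- The Cramér–Wold device at the level of characteristic functions: it reduces the vector case to
-- the scalar central limit theorem, evaluated at frequency 1.
omit [IsProbabilityMeasure P] in
lemma charFun_map_eq_charFun_map_inner {E : Type*} [NormedAddCommGroup E] [InnerProductSpace ℝ E]
    [MeasurableSpace E] [BorelSpace E] [SecondCountableTopology E] {X : Ω → E}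
    (hX : AEMeasurable X P) (t : E) :
    charFun (P.map X) t = charFun (P.map fun ω => inner ℝ (X ω) t) 1 := by
  have h : AEMeasurable (fun ω => inner ℝ (X ω) t) P := hX.inner_const
  rw [charFun_apply, charFun_apply_real, integral_map hX, integral_map h]
  · simp
  · fun_prop
  · fun_prop

/-- The **central limit theorem** for i.i.d. square integrable centered random vectors. -/
theorem tendstoInDistribution_inv_sqrt_smul_sum [DecidableEq ι] {X : ℕ → Ω → EuclideanSpace ℝ ι}
    {S : Matrix ι ι ℝ} (hS : S.PosSemidef) (hX : ∀ t, MemLp (fun ω => inner ℝ (X 0 ω) t) 2 P)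
    (h0 : ∀ t, ∫ ω, inner ℝ (X 0 ω) t ∂P = 0)
    (hcov : ∀ t, ∫ ω, inner ℝ (X 0 ω) t ^ 2 ∂P = t ⬝ᵥ S.mulVec t)
    (hindep : iIndepFun X P) (hident : ∀ i, IdentDistrib (X i) (X 0) P P) :
    TendstoInDistribution (fun (n : ℕ) ω => (√(n : ℝ))⁻¹ • ∑ i ∈ Finset.range n, X i ω) atTop
      (id : EuclideanSpace ℝ ι → EuclideanSpace ℝ ι) (fun _ => P) (multivariateGaussian 0 S) := by
  have hm (n : ℕ) : AEMeasurable (X n) P := (hident n).aemeasurable_fst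
  have hsum (n : ℕ) :
      AEMeasurable (fun ω => (√(n : ℝ))⁻¹ • ∑ i ∈ Finset.range n, X i ω) P := by
    fun_prop
  refine ⟨hsum, aemeasurable_id, ?_⟩
  refine ProbabilityMeasure.tendsto_iff_tendsto_charFun.2 fun t => ?_
  have hvar : Var[fun ω => inner ℝ (X 0 ω) t; P] = t ⬝ᵥ S.mulVec t := by
    rw [variance_of_integral_eq_zero (hX t).aemeasurable (h0 t), hcov]
  have clt := tendstoInDistribution_inv_sqrt_mul_sum_sub (P := P) (X := fun i ω => inner ℝ (X i ω) t)
    (Y := id) (P' := gaussianReal 0 (Var[fun ω => inner ℝ (X 0 ω) t; P]).toNNReal)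
    ⟨aemeasurable_id, Measure.map_id⟩ (hX t)
    (hindep.comp (fun _ x => inner ℝ x t) (fun _ => by fun_prop))
    (fun i => (hident i).comp (u := fun x => inner ℝ x t) (by fun_prop))
  have h1 := ProbabilityMeasure.tendsto_iff_tendsto_charFun.1 clt.tendsto 1
  simp only [ProbabilityMeasure.coe_mk, Measure.map_id, charFun_gaussianReal, h0, hvar] at h1
  simp only [ProbabilityMeasure.coe_mk, Measure.map_id, charFun_multivariateGaussian hS]
  convert! h1 using 2 with n
  · rw [charFun_map_eq_charFun_map_inner (hsum n)]
    congr! 3 with ω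
    simp [inner_smul_left, sum_inner]
  · have : 0 ≤ t ⬝ᵥ S.mulVec t := hvar ▸ variance_nonneg _ _
    simp [Real.coe_toNNReal _ this]

end CentralLimit

/-! ### Averages over i.i.d. samples -/

section Average

variable {Ω 𝒵 : Type*} [MeasurableSpace Ω] [MeasurableSpace 𝒵] {P : Measure Ω}
  {Z : ℕ → Ω → 𝒵}

/-- The strong law of large numbers for a function of an i.i.d. sample. -/
lemma ae_tendsto_average {F : Type*} [NormedAddCommGroup F] [NormedSpace ℝ F] [CompleteSpace F]
    [MeasurableSpace F] [BorelSpace F] (hind : iIndepFun Z P)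
    (hid : ∀ i, IdentDistrib (Z i) (Z 0) P P) {φ : 𝒵 → F}
    (hφ : AEMeasurable φ (P.map (Z 0))) (hint : Integrable (fun ω => φ (Z 0 ω)) P) :
    ∀ᵐ ω ∂P, Tendsto (fun n : ℕ => (n : ℝ)⁻¹ • ∑ i ∈ Finset.range n, φ (Z i ω)) atTop
      (𝓝 (∫ ω, φ (Z 0 ω) ∂P)) := by
  have hφ' (i : ℕ) : AEMeasurable φ (P.map (Z i)) := (hid i).map_eq ▸ hφ
  refine strong_law_ae (fun i ω => φ (Z i ω)) hint ?_ ?_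
  · intro i j hij
    exact (hind.comp₀ (fun _ => φ) (fun i => (hid i).aemeasurable_fst) hφ').indepFun hij
  · exact fun i => (hid i).comp_of_aemeasurable (hφ' i)

lemma ae_forall_of_ae_map (hid : ∀ i, IdentDistrib (Z i) (Z 0) P P) {p : 𝒵 → Prop}
    (hp : ∀ᵐ z ∂(P.map (Z 0)), p z) : ∀ᵐ ω ∂P, ∀ i, p (Z i ω) :=
  ae_all_iff.2 fun i => ae_of_ae_map (hid i).aemeasurable_fst ((hid i).map_eq ▸ hp)

/-! ### Consistency of minimum contrast estimators -/

variable {E : Type*} [MetricSpace E] {Θ : Set E} {h : 𝒵 → E → ℝ} {M : ℝ}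

/-- `v` is the infimum of `h z` over the points of `Q` in a small ball about `t`. Countability of
`Q` makes it measurable; continuity makes it converge to `h z t` as the ball shrinks, so dominated
convergence brings its expectation above `c`. Density and continuity extend the lower bound from `Q`
to `Θ`. -/
lemma exists_local_lower_bound [IsFiniteMeasure P] {Q : Set E} (hQΘ : Q ⊆ Θ) (hQ : Q.Countable)
    (hΘQ : Θ ⊆ closure Q) (hZ : AEMeasurable (Z 0) P)
    (hm : ∀ θ ∈ Θ, AEMeasurable (fun z => h z θ) (P.map (Z 0)))
    (hb : ∀ θ ∈ Θ, ∀ z, |h z θ| ≤ M) (hc : ∀ᵐ z ∂(P.map (Z 0)), ContinuousOn (h z) Θ)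
    {t : E} (ht : t ∈ Θ) {c : ℝ} (hct : c < ∫ ω, h (Z 0 ω) t ∂P) :
    ∃ r > 0, ∃ v : 𝒵 → ℝ, AEMeasurable v (P.map (Z 0)) ∧ (∀ z, |v z| ≤ M) ∧
      c < ∫ ω, v (Z 0 ω) ∂P ∧
      ∀ z, ContinuousOn (h z) Θ → ∀ θ ∈ Θ ∩ Metric.ball t r, v z ≤ h z θ := by
  have hr (m : ℕ) : (0 : ℝ) < 1 / (m + 1) := Nat.one_div_pos_of_nat
  let I (m : ℕ) : Type _ := {q // q ∈ Q ∧ dist q t < 1 / ((m : ℝ) + 1)}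
  have hI (m : ℕ) : Nonempty (I m) := by
    obtain ⟨q, hq, hqt⟩ := Metric.mem_closure_iff.1 (hΘQ ht) _ (hr m)
    exact ⟨⟨q, hq, by rwa [dist_comm]⟩⟩
  have hIc (m : ℕ) : Countable (I m) := by
    have : Countable Q := hQ.to_subtype
    exact Function.Injective.countable (f := fun q : I m => (⟨q.1, q.2.1⟩ : Q))
      fun a b hab => Subtype.ext (by simpa using hab)
  let v (m : ℕ) (z : 𝒵) : ℝ := ⨅ q : I m, h z q.1
  have hbdd (m : ℕ) (z : 𝒵) : BddBelow (Set.range fun q : I m => h z q.1) :=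
    ⟨-M, by rintro _ ⟨q, rfl⟩; exact (abs_le.1 (hb _ (hQΘ q.2.1) z)).1⟩
  have hvm (m : ℕ) : AEMeasurable (v m) (P.map (Z 0)) :=
    AEMeasurable.iInf fun q => hm _ (hQΘ q.2.1)
  have hvb (m : ℕ) (z : 𝒵) : |v m z| ≤ M := by
    refine abs_le.2 ⟨le_ciInf fun q => (abs_le.1 (hb _ (hQΘ q.2.1) z)).1, ?_⟩
    obtain ⟨q⟩ := hI m
    exact (ciInf_le (hbdd m z) q).trans (abs_le.1 (hb _ (hQΘ q.2.1) z)).2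
  have hlim : Tendsto (fun m => ∫ ω, v m (Z 0 ω) ∂P) atTop (𝓝 (∫ ω, h (Z 0 ω) t ∂P)) := by
    refine tendsto_integral_of_dominated_convergence (fun _ => M)
      (fun m => ((hvm m).comp_aemeasurable hZ).aestronglyMeasurable) (integrable_const _)
      (fun m => Eventually.of_forall fun ω => hvb m _) ?_
    filter_upwards [ae_of_ae_map hZ hc] with ω hω
    rw [Metric.tendsto_atTop]
    intro ε hε
    obtain ⟨δ, hδ, hδ'⟩ := Metric.continuousWithinAt_iff.1 (hω t ht) (ε / 2) (half_pos hε)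
    obtain ⟨N, hN⟩ := exists_nat_one_div_lt hδ
    refine ⟨N, fun m hm => ?_⟩
    have hq (q : I m) : dist (h (Z 0 ω) q.1) (h (Z 0 ω) t) < ε / 2 :=
      hδ' (hQΘ q.2.1) (q.2.2.trans ((Nat.one_div_le_one_div hm).trans_lt hN))
    simp only [Real.dist_eq, abs_lt] at hq
    rw [Real.dist_eq]
    refine lt_of_le_of_lt (abs_le.2 ⟨?_, ?_⟩) (half_lt_self hε)
    · have : h (Z 0 ω) t - ε / 2 ≤ v m (Z 0 ω) := le_ciInf fun q => by linarith [(hq q).1]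
      linarith
    · obtain ⟨q⟩ := hI m
      linarith [ciInf_le (hbdd m (Z 0 ω)) q, (hq q).2]
  obtain ⟨m, hm⟩ := (hlim.eventually_const_lt hct).exists
  refine ⟨_, hr m, v m, hvm m, hvb m, hm, fun z hz θ hθ => ?_⟩
  have hcl : θ ∈ closure (Q ∩ Metric.ball t (1 / ((m : ℝ) + 1))) :=
    Metric.isOpen_ball.closure_inter (s := Q) |>.trans le_rfl |> fun H => H ⟨hΘQ hθ.1, hθ.2⟩
  have hcont : ContinuousWithinAt (h z) (Q ∩ Metric.ball t (1 / ((m : ℝ) + 1))) θ :=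
    (hz θ hθ.1).mono fun q hq => hQΘ hq.1
  have := mem_closure_iff_nhdsWithin_neBot.1 hcl
  refine ge_of_tendsto hcont.tendsto (eventually_nhdsWithin_of_forall fun q hq => ?_)
  exact ciInf_le (hbdd m z) (⟨q, hq.1, hq.2⟩ : I m)

/-- Minimizers of the empirical contrast over a compact set converge almost surely to the unique
minimizer of the expected contrast. -/
theorem ae_tendsto_of_minimizer [IsProbabilityMeasure P] (hind : iIndepFun Z P)
    (hid : ∀ i, IdentDistrib (Z i) (Z 0) P P) (hΘ : IsCompact Θ)
    (hm : ∀ θ ∈ Θ, AEMeasurable (fun z => h z θ) (P.map (Z 0)))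
    (hb : ∀ θ ∈ Θ, ∀ z, |h z θ| ≤ M) (hc : ∀ᵐ z ∂(P.map (Z 0)), ContinuousOn (h z) Θ)
    {θs : E} (hθs : θs ∈ Θ)
    (hmin : ∀ t ∈ Θ, t ≠ θs → ∫ ω, h (Z 0 ω) θs ∂P < ∫ ω, h (Z 0 ω) t ∂P)
    {θhat : ℕ → Ω → E} (hθhat : ∀ n, 1 ≤ n → ∀ᵐ ω ∂P, θhat n ω ∈ Θ ∧
      ∑ i ∈ Finset.range n, h (Z i ω) (θhat n ω) ≤ ∑ i ∈ Finset.range n, h (Z i ω) θs) :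
    ∀ᵐ ω ∂P, Tendsto (fun n => θhat n ω) atTop (𝓝 θs) := by
  have hZ : AEMeasurable (Z 0) P := (hid 0).aemeasurable_fst
  obtain ⟨Q, hQΘ, hQ, hΘQ⟩ := hΘ.isSeparable.exists_countable_dense_subset
  have hint {v : 𝒵 → ℝ} (hv : AEMeasurable v (P.map (Z 0))) (hvb : ∀ z, |v z| ≤ M) :
      Integrable (fun ω => v (Z 0 ω)) P :=
    Integrable.of_bound (hv.comp_aemeasurable hZ).aestronglyMeasurable M
      (Eventually.of_forall fun ω => hvb _)
  have hcont := ae_forall_of_ae_map hid hc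
  have hhat : ∀ᵐ ω ∂P, ∀ n, 1 ≤ n → θhat n ω ∈ Θ ∧
      ∑ i ∈ Finset.range n, h (Z i ω) (θhat n ω) ≤ ∑ i ∈ Finset.range n, h (Z i ω) θs :=
    ae_all_iff.2 fun n => by
      by_cases hn : 1 ≤ n
      · filter_upwards [hθhat n hn] with ω hω using fun _ => hω
      · exact Eventually.of_forall fun ω h => absurd h hn
  have hs := ae_tendsto_average hind hid (hm θs hθs) (hint (hm θs hθs) (hb θs hθs))
  -- Only the countable family of radii `1 / (k + 1)` is used, so that the exceptional null sets can
  -- be united.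
  have hmain : ∀ k : ℕ, ∀ᵐ ω ∂P, ∀ᶠ n in atTop, dist (θhat n ω) θs < 1 / ((k : ℝ) + 1) := by
    intro k
    have hK : IsCompact (Θ \ Metric.ball θs (1 / ((k : ℝ) + 1))) := hΘ.diff Metric.isOpen_ball
    have hloc (t : E) (ht : t ∈ Θ \ Metric.ball θs (1 / ((k : ℝ) + 1))) :=
      exists_local_lower_bound hQΘ hQ hΘQ hZ hm hb hc ht.1 (hmin t ht.1 (by
        rintro rfl
        exact ht.2 (Metric.mem_ball_self Nat.one_div_pos_of_nat)))
    choose! r hr v hvm hvb hvlt hvle using hloc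
    obtain ⟨s, hsK, hs_cover⟩ := hK.elim_nhds_subcover (fun t => Metric.ball t (r t))
      fun t ht => Metric.ball_mem_nhds t (hr t ht)
    have hav : ∀ᵐ ω ∂P, ∀ t ∈ s, Tendsto
        (fun n : ℕ => (n : ℝ)⁻¹ • ∑ i ∈ Finset.range n, v t (Z i ω)) atTop
        (𝓝 (∫ ω, v t (Z 0 ω) ∂P)) :=
      (ae_ball_iff s.countable_toSet).2 fun t ht =>
        ae_tendsto_average hind hid (hvm t (hsK t ht)) (hint (hvm t (hsK t ht)) (hvb t (hsK t ht)))
    filter_upwards [hs, hav, hcont, hhat] with ω hω1 hω2 hω3 hω4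
    have hev : ∀ᶠ n : ℕ in atTop, ∀ t ∈ s, (n : ℝ)⁻¹ • ∑ i ∈ Finset.range n, h (Z i ω) θs <
        (n : ℝ)⁻¹ • ∑ i ∈ Finset.range n, v t (Z i ω) :=
      (eventually_all_finset s).2 fun t ht => hω1.eventually_lt (hω2 t ht) (hvlt t (hsK t ht))
    filter_upwards [hev, eventually_ge_atTop 1] with n hn hn1
    -- A minimizer outside the ball would lie in one of the finitely many covering balls, where the
    -- empirical contrast is at least the average of `v t`, which already exceeds the empirical
    -- contrast at `θs`.
    by_contra hcon
    obtain ⟨hmem, hle⟩ := hω4 n hn1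
    obtain ⟨t, hts, htb⟩ := Set.mem_iUnion₂.1 (hs_cover ⟨hmem, hcon⟩)
    have hn0 : (0 : ℝ) < (n : ℝ)⁻¹ := by positivity
    have h1 := hn t hts
    rw [smul_eq_mul, smul_eq_mul, mul_lt_mul_iff_right₀ hn0] at h1
    refine absurd (h1.trans_le ?_) (not_lt.2 hle)
    exact Finset.sum_le_sum fun i _ => hvle t (hsK t hts) _ (hω3 i) _ ⟨hmem, htb⟩
  filter_upwards [ae_all_iff.2 hmain] with ω hω
  rw [Metric.tendsto_nhds]
  intro ε hε
  obtain ⟨k, hk⟩ := exists_nat_one_div_lt hε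
  filter_upwards [hω k] with n hn using hn.trans hk

end Average

/-! ### Measurability of derivatives in a parameter -/

section DerivMeasurable

variable {𝒵 : Type*} [MeasurableSpace 𝒵] {μ : Measure 𝒵}

/-- A directional derivative is the limit of difference quotients along `θ + v / n`, so
measurability in `z` for each fixed parameter near `θ` suffices; the shift by `N` keeps the points
in that neighbourhood. -/
lemma aemeasurable_fderiv_apply_of_eventually {E G : Type*} [NormedAddCommGroup E]
    [NormedSpace ℝ E] [NormedAddCommGroup G] [NormedSpace ℝ G] [MeasurableSpace G] [BorelSpace G]
    [SecondCountableTopology G] {F : 𝒵 → E → G} {θ : E}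
    (hF : ∀ᶠ t in 𝓝 θ, AEMeasurable (fun z => F z t) μ)
    (hd : ∀ᵐ z ∂μ, DifferentiableAt ℝ (F z) θ) (v : E) :
    AEMeasurable (fun z => fderiv ℝ (F z) θ v) μ := by
  have hc : Tendsto (fun n : ℕ => (n : ℝ)⁻¹) atTop (𝓝 0) := tendsto_inv_atTop_nhds_zero_nat
  have ht : Tendsto (fun n : ℕ => θ + (n : ℝ)⁻¹ • v) atTop (𝓝 θ) := by
    simpa using (hc.smul_const v).const_add θ
  obtain ⟨N, hN⟩ := eventually_atTop.1 (ht.eventually hF)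
  have hnorm : Tendsto (fun n : ℕ => ‖((n + N : ℕ) : ℝ)‖) atTop atTop := by
    simp only [Real.norm_natCast]
    exact tendsto_natCast_atTop_atTop.comp (tendsto_add_atTop_nat N)
  refine aemeasurable_of_tendsto_metrizable_ae atTop (f := fun (n : ℕ) z =>
    ((n + N : ℕ) : ℝ) • (F z (θ + ((n + N : ℕ) : ℝ)⁻¹ • v) - F z θ)) (fun n => ?_) ?_
  · exact ((hN (n + N) (Nat.le_add_left _ _)).sub hF.self_of_nhds).const_smul _
  · filter_upwards [hd] with z hz
    exact hz.hasFDerivAt.lim v hnorm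

lemma aemeasurable_fderiv_of_eventually {ι G : Type*} [Fintype ι]
    [NormedAddCommGroup G] [NormedSpace ℝ G] [MeasurableSpace G] [BorelSpace G]
    [SecondCountableTopology G] {F : 𝒵 → EuclideanSpace ℝ ι → G} {θ : EuclideanSpace ℝ ι}
    (hF : ∀ᶠ t in 𝓝 θ, AEMeasurable (fun z => F z t) μ)
    (hd : ∀ᵐ z ∂μ, DifferentiableAt ℝ (F z) θ) :
    AEMeasurable (fun z => fderiv ℝ (F z) θ) μ := by
  classical
  -- `Φ` rebuilds a linear map continuously from its values on the standard basis, so measurability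
  -- in each basis direction is enough.
  let Φ : (ι → G) → EuclideanSpace ℝ ι →L[ℝ] G := fun v =>
    ∑ j, ContinuousLinearMap.smulRightL ℝ (EuclideanSpace ℝ ι) G (EuclideanSpace.proj j) (v j)
  have hΦ : Continuous Φ := by fun_prop
  have hΦ' (L : EuclideanSpace ℝ ι →L[ℝ] G) : Φ (fun j => L (EuclideanSpace.single j 1)) = L := by
    ext x
    conv_rhs => rw [← (EuclideanSpace.basisFun ι ℝ).sum_repr x, map_sum]
    simp [Φ]
  have : (fun z => fderiv ℝ (F z) θ) =
      fun z => Φ fun j => fderiv ℝ (F z) θ (EuclideanSpace.single j 1) := by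
    simp only [hΦ']
  rw [this]
  exact hΦ.measurable.comp_aemeasurable (aemeasurable_pi_lambda _ fun j =>
    aemeasurable_fderiv_apply_of_eventually hF hd _)

variable {ι : Type*} [Fintype ι]

lemma TwiceDifferentiableAt.differentiableAt {F : EuclideanSpace ℝ ι → ℝ} {θ : EuclideanSpace ℝ ι}
    (hF : TwiceDifferentiableAt F θ) : DifferentiableAt ℝ F θ :=
  hF.1.self_of_nhds

lemma TwiceDifferentiableAt.differentiableAt_gradient {F : EuclideanSpace ℝ ι → ℝ}
    {θ : EuclideanSpace ℝ ι} (hF : TwiceDifferentiableAt F θ) :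
    DifferentiableAt ℝ (gradient F) θ :=
  ((InnerProductSpace.toDual ℝ (EuclideanSpace ℝ ι)).symm.toContinuousLinearEquiv
    |>.differentiableAt).comp θ hF.2

lemma aemeasurable_gradient_of_eventually {F : 𝒵 → EuclideanSpace ℝ ι → ℝ}
    {θ : EuclideanSpace ℝ ι} (hF : ∀ᶠ t in 𝓝 θ, AEMeasurable (fun z => F z t) μ)
    (hd : ∀ᵐ z ∂μ, DifferentiableAt ℝ (F z) θ) :
    AEMeasurable (fun z => gradient (F z) θ) μ :=
  (InnerProductSpace.toDual ℝ (EuclideanSpace ℝ ι)).symm.continuous.measurable.comp_aemeasurable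
    (aemeasurable_fderiv_of_eventually hF hd)

end DerivMeasurable

/-! ### Linearization of averages -/

section Linearization

variable {Ω 𝒵 : Type*} [MeasurableSpace Ω] [MeasurableSpace 𝒵] {P : Measure Ω}
  {Z : ℕ → Ω → 𝒵} {E F : Type*} [NormedAddCommGroup E] [NormedSpace ℝ E]
  [NormedAddCommGroup F] [NormedSpace ℝ F]

/-- The error of the first order expansion of `s` at `x`. -/
noncomputable def linearizationError (s : E → F) (x y : E) : F := s y - s x - fderiv ℝ s x (y - x)

/-- The mean value inequality bounds the increment and the linear part by `D * ‖y - x‖` each, whence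
the factor 2. -/
lemma norm_linearizationError_le {s : E → F} {x : E} {r D : ℝ} (hr : 0 < r)
    (hd : ∀ y ∈ Metric.ball x r, DifferentiableAt ℝ s y)
    (hD : ∀ y ∈ Metric.ball x r, ‖fderiv ℝ s y‖ ≤ D) {y : E} (hy : y ∈ Metric.ball x r) :
    ‖linearizationError s x y‖ ≤ 2 * D * ‖y - x‖ := by
  have hx : x ∈ Metric.ball x r := Metric.mem_ball_self hr
  have h1 := (convex_ball x r).norm_image_sub_le_of_norm_fderiv_le hd hD hx hy
  have h2 := (fderiv ℝ s x).le_of_opNorm_le (hD x hx) (y - x)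
  calc ‖linearizationError s x y‖ ≤ ‖s y - s x‖ + ‖fderiv ℝ s x (y - x)‖ := norm_sub_le _ _
    _ ≤ 2 * D * ‖y - x‖ := by linarith

variable [SecondCountableTopology E] [MeasurableSpace F] [BorelSpace F]
  [SecondCountableTopology F] {s : 𝒵 → E → F} {x : E} {r : ℝ}

/-- The weight `w` is the supremum of the relative linearization error over a small ball. It tends
to 0 with the radius by differentiability at `x` alone, and `2 * D` dominates it, so its expectation
can be made less than `ε`. Continuity of the derivative is not needed. -/
lemma exists_linearizationError_bound (hr : 0 < r) (hZ : AEMeasurable (Z 0) P)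
    (hsm : ∀ y ∈ Metric.ball x r, AEMeasurable (fun z => s z y) (P.map (Z 0)))
    (hAm : AEMeasurable (fun z => fderiv ℝ (s z) x) (P.map (Z 0)))
    (hd : ∀ᵐ z ∂(P.map (Z 0)), ∀ y ∈ Metric.ball x r, DifferentiableAt ℝ (s z) y)
    {D : Ω → ℝ} (hDi : Integrable D P)
    (hD : ∀ᵐ ω ∂P, ∀ y ∈ Metric.ball x r, ‖fderiv ℝ (s (Z 0 ω)) y‖ ≤ D ω) {ε : ℝ} (hε : 0 < ε) :
    ∃ δ > 0, ∃ w : 𝒵 → ℝ, AEMeasurable w (P.map (Z 0)) ∧ Integrable (fun ω => w (Z 0 ω)) P ∧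
      ∫ ω, w (Z 0 ω) ∂P < ε ∧ ∀ᵐ z ∂(P.map (Z 0)), ∀ y ∈ Metric.ball x δ,
        ‖linearizationError (s z) x y‖ ≤ w z * ‖y - x‖ := by
  have hx : x ∈ Metric.ball x r := Metric.mem_ball_self hr
  obtain ⟨Q, hQ, hQd⟩ := TopologicalSpace.exists_countable_dense E
  let δ (m : ℕ) : ℝ := r * (1 / ((m : ℝ) + 1))
  have hδ (m : ℕ) : 0 < δ m := mul_pos hr Nat.one_div_pos_of_nat
  have hδr (m : ℕ) : δ m ≤ r := by
    refine mul_le_of_le_one_right hr.le ?_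
    rw [div_le_one (by positivity)]
    linarith [(Nat.cast_nonneg m : (0 : ℝ) ≤ m)]
  have hball (m : ℕ) : Metric.ball x (δ m) ⊆ Metric.ball x r := Metric.ball_subset_ball (hδr m)
  let I (m : ℕ) : Type _ := {q // q ∈ Q ∩ Metric.ball x (δ m)}
  have hIc (m : ℕ) : Countable (I m) := (hQ.mono Set.inter_subset_left).to_subtype
  -- A countable supremum in `ℝ≥0∞` is measurable and needs no boundedness for its definition. If `x
  -- ∈ Q`, the term at `q = x` is `0 / 0 = 0`.
  let W (m : ℕ) (z : 𝒵) : ℝ≥0∞ :=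
    ⨆ q : I m, ENNReal.ofReal (‖linearizationError (s z) x q.1‖ / ‖q.1 - x‖)
  have hWm (m : ℕ) : AEMeasurable (W m) (P.map (Z 0)) := by
    refine AEMeasurable.iSup fun q => ?_
    have h1 := hsm _ (hball m q.2.2)
    have h2 := hsm x hx
    have h3 : AEMeasurable (fun z => fderiv ℝ (s z) x (q.1 - x)) (P.map (Z 0)) :=
      (ContinuousLinearMap.apply ℝ F (q.1 - x)).continuous.measurable.comp_aemeasurable hAm
    exact (((h1.sub h2).sub h3).norm.div_const _).ennreal_ofReal
  have hWD : ∀ᵐ ω ∂P, ∀ m, W m (Z 0 ω) ≤ ENNReal.ofReal (2 * D ω) := by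
    filter_upwards [hD, ae_of_ae_map hZ hd] with ω hω hω' m
    refine iSup_le fun q => ENNReal.ofReal_le_ofReal ?_
    refine div_le_of_le_mul₀ (norm_nonneg _) ?_
      (norm_linearizationError_le hr hω' hω (hball m q.2.2))
    exact mul_nonneg zero_le_two ((norm_nonneg _).trans (hω x hx))
  have hWfin (m : ℕ) : ∀ᵐ z ∂(P.map (Z 0)), W m z < ∞ := by
    refine ae_lt_top' (hWm m) (ne_of_lt ?_)
    rw [lintegral_map' (hWm m) hZ]
    calc ∫⁻ ω, W m (Z 0 ω) ∂P ≤ ∫⁻ ω, ENNReal.ofReal (2 * D ω) ∂P :=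
          lintegral_mono_ae (hWD.mono fun ω hω => hω m)
      _ < ∞ := (hDi.const_mul 2).lintegral_lt_top
  have hwm (m : ℕ) : AEMeasurable (fun z => (W m z).toReal) (P.map (Z 0)) :=
    (hWm m).ennreal_toReal
  have hwm' (m : ℕ) : AEStronglyMeasurable (fun ω => (W m (Z 0 ω)).toReal) P :=
    ((hwm m).comp_aemeasurable hZ).aestronglyMeasurable
  have hD0 : ∀ᵐ ω ∂P, 0 ≤ D ω := hD.mono fun ω hω => (norm_nonneg _).trans (hω x hx)
  have hwD (m : ℕ) : ∀ᵐ ω ∂P, ‖(W m (Z 0 ω)).toReal‖ ≤ 2 * D ω := by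
    filter_upwards [hWD, hD0] with ω hω h0
    rw [Real.norm_of_nonneg ENNReal.toReal_nonneg]
    exact ENNReal.toReal_le_of_le_ofReal (by positivity) (hω m)
  have hlim : Tendsto (fun m => ∫ ω, (W m (Z 0 ω)).toReal ∂P) atTop (𝓝 (∫ _, (0 : ℝ) ∂P)) := by
    refine tendsto_integral_of_dominated_convergence (fun ω => 2 * D ω) hwm' (hDi.const_mul 2)
      hwD ?_
    filter_upwards [ae_of_ae_map hZ hd] with ω hω
    rw [Metric.tendsto_atTop]
    intro ε hε
    have h1 := ((hω x hx).hasFDerivAt.isLittleO).def (half_pos hε)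
    obtain ⟨ρ, hρ, hρ'⟩ := Metric.eventually_nhds_iff.1 h1
    obtain ⟨N, hN⟩ := exists_nat_one_div_lt (div_pos hρ hr)
    refine ⟨N, fun m hm => ?_⟩
    have hδρ : δ m < ρ := by
      have := (Nat.one_div_le_one_div (α := ℝ) hm).trans_lt hN
      rw [lt_div_iff₀ hr] at this
      simpa [δ, mul_comm] using this
    rw [Real.dist_eq, sub_zero, abs_of_nonneg ENNReal.toReal_nonneg]
    refine lt_of_le_of_lt ?_ (half_lt_self hε)
    refine ENNReal.toReal_le_of_le_ofReal (by positivity) ?_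
    refine iSup_le fun q => ENNReal.ofReal_le_ofReal ?_
    exact div_le_of_le_mul₀ (norm_nonneg _) (by positivity)
      (hρ' ((Metric.mem_ball.1 q.2.2).trans hδρ))
  rw [integral_zero] at hlim
  obtain ⟨m, hm⟩ := (hlim.eventually_lt_const hε).exists
  refine ⟨δ m, hδ m, fun z => (W m z).toReal, hwm m, (hDi.const_mul 2).mono' (hwm' m) (hwD m),
    hm, ?_⟩
  filter_upwards [hd, hWfin m] with z hz hzfin y hy
  have hcl : y ∈ closure (Q ∩ Metric.ball x (δ m)) := by
    rw [Set.inter_comm]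
    exact hQd.open_subset_closure_inter Metric.isOpen_ball hy
  have := mem_closure_iff_nhdsWithin_neBot.1 hcl
  have hcy : ContinuousAt (s z) y := (hz y (hball m hy)).continuousAt
  have hc1 : ContinuousAt (fun y => ‖linearizationError (s z) x y‖) y := by
    unfold linearizationError
    fun_prop
  have hc2 : ContinuousAt (fun y => (W m z).toReal * ‖y - x‖) y := by fun_prop
  refine le_of_tendsto_of_tendsto (b := 𝓝[Q ∩ Metric.ball x (δ m)] y) (hc1.mono_left nhdsWithin_le_nhds)
    (hc2.mono_left nhdsWithin_le_nhds) (eventually_nhdsWithin_of_forall fun q hq => ?_)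
  rcases eq_or_ne q x with rfl | hqx
  · simp [linearizationError]
  · rw [← div_le_iff₀ (norm_pos_iff.2 (sub_ne_zero.2 hqx))]
    rw [← ENNReal.ofReal_le_iff_le_toReal hzfin.ne]
    exact le_iSup (fun q : I m =>
      ENNReal.ofReal (‖linearizationError (s z) x q.1‖ / ‖q.1 - x‖)) ⟨q, hq⟩

/-- The average linearization error of an i.i.d. sample is of smaller order along every sequence
that converges to the base point. -/
lemma ae_average_linearizationError_isLittleO (hind : iIndepFun Z P)
    (hid : ∀ i, IdentDistrib (Z i) (Z 0) P P) (hr : 0 < r)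
    (hsm : ∀ y ∈ Metric.ball x r, AEMeasurable (fun z => s z y) (P.map (Z 0)))
    (hAm : AEMeasurable (fun z => fderiv ℝ (s z) x) (P.map (Z 0)))
    (hd : ∀ᵐ z ∂(P.map (Z 0)), ∀ y ∈ Metric.ball x r, DifferentiableAt ℝ (s z) y)
    {D : Ω → ℝ} (hDi : Integrable D P)
    (hD : ∀ᵐ ω ∂P, ∀ y ∈ Metric.ball x r, ‖fderiv ℝ (s (Z 0 ω)) y‖ ≤ D ω) :
    ∀ᵐ ω ∂P, ∀ t : ℕ → E, Tendsto t atTop (𝓝 x) →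
      (fun n : ℕ => (n : ℝ)⁻¹ • ∑ i ∈ Finset.range n, linearizationError (s (Z i ω)) x (t n))
        =o[atTop] fun n => t n - x := by
  have hk (k : ℕ) := exists_linearizationError_bound hr (hid 0).aemeasurable_fst hsm hAm hd hDi hD
    (Nat.one_div_pos_of_nat (α := ℝ) (n := k))
  choose δ hδ w hwm hwi hwlt hwle using hk
  -- The exceptional set is fixed before the sequence `t` is chosen, so `t` may depend on `ω`, as
  -- the estimator does.
  filter_upwards [ae_all_iff.2 fun k => ae_tendsto_average hind hid (hwm k) (hwi k),
    ae_all_iff.2 fun k => ae_forall_of_ae_map hid (hwle k)] with ω hω1 hω2 t ht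
  refine Asymptotics.isLittleO_iff.2 fun c hc => ?_
  obtain ⟨k, hkc⟩ := exists_nat_one_div_lt hc
  filter_upwards [(hω1 k).eventually_lt_const ((hwlt k).trans hkc),
    ht.eventually (Metric.ball_mem_nhds x (hδ k))] with n hn hnt
  have hn0 : (0 : ℝ) ≤ (n : ℝ)⁻¹ := by positivity
  calc ‖(n : ℝ)⁻¹ • ∑ i ∈ Finset.range n, linearizationError (s (Z i ω)) x (t n)‖
      ≤ (n : ℝ)⁻¹ * ∑ i ∈ Finset.range n, w k (Z i ω) * ‖t n - x‖ := by
        rw [norm_smul, Real.norm_of_nonneg hn0]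
        exact mul_le_mul_of_nonneg_left
          ((norm_sum_le _ _).trans (Finset.sum_le_sum fun i _ => hω2 k i _ hnt)) hn0
    _ = ((n : ℝ)⁻¹ • ∑ i ∈ Finset.range n, w k (Z i ω)) * ‖t n - x‖ := by
        rw [← Finset.sum_mul, smul_eq_mul, mul_assoc]
    _ ≤ c * ‖t n - x‖ := mul_le_mul_of_nonneg_right hn.le (norm_nonneg _)

end Linearization

/-! ### Asymptotic normality of minimum contrast estimators -/

section AsymptoticNormality

variable {Ω Ω' : Type*} [MeasurableSpace Ω] {P : Measure Ω} [IsProbabilityMeasure P]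
  [MeasurableSpace Ω'] {P' : Measure Ω'} [IsProbabilityMeasure P']

/-- A sequence that is almost surely asymptotically equivalent to a sequence that converges in
distribution has the same limit in distribution. -/
lemma MeasureTheory.TendstoInDistribution.of_sub_isLittleO {E : Type*} [NormedAddCommGroup E]
    [NormedSpace ℝ E] [SecondCountableTopology E] [MeasurableSpace E] [BorelSpace E]
    {X T : ℕ → Ω → E} {L : Ω' → E} (hX : TendstoInDistribution X atTop L (fun _ => P) P')
    (hT : ∀ n, AEMeasurable (T n) P)
    (h : ∀ᵐ ω ∂P, (fun n => T n ω - X n ω) =o[atTop] fun n => X n ω) :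
    TendstoInDistribution T atTop L (fun _ => P) P' := by
  have hXm := hX.forall_aemeasurable
  -- Relative error: `T = X + ‖X‖ • ρ` eventually, almost surely, with `ρ → 0`. Slutsky's theorem
  -- applies to `(x, e) ↦ x + ‖x‖ • e`. Where `X = 0`, the convention `0⁻¹ = 0` is harmless, because
  -- the little-o bound eventually forces `T = 0` there.
  let ρ (n : ℕ) (ω : Ω) : E := ‖X n ω‖⁻¹ • (T n ω - X n ω)
  have hρm (n : ℕ) : AEMeasurable (ρ n) P := by
    have := hXm n
    have := hT n
    fun_prop
  have hρ : TendstoInMeasure P ρ atTop fun _ => 0 := by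
    refine tendstoInMeasure_of_tendsto_ae (fun n => (hρm n).aestronglyMeasurable) ?_
    filter_upwards [h] with ω hω
    rw [tendsto_zero_iff_norm_tendsto_zero]
    refine (hω.norm_norm.tendsto_div_nhds_zero).congr fun n => ?_
    rw [norm_smul, norm_inv, norm_norm, div_eq_inv_mul]
  have h1 := hX.continuous_comp_prodMk_of_tendstoInMeasure_const
    (g := fun z : E × E => z.1 + ‖z.1‖ • z.2) (by fun_prop) hρ hρm
  simp only [smul_zero, add_zero] at h1
  refine tendstoInDistribution_of_tendstoInMeasure_sub T L h1 ?_ hT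
  refine tendstoInMeasure_of_tendsto_ae (fun n => ?_) ?_
  · have := hXm n
    have := hT n
    have := hρm n
    exact AEMeasurable.aestronglyMeasurable
      (f := fun ω => T n ω - (X n ω + ‖X n ω‖ • ρ n ω)) (by fun_prop)
  · filter_upwards [h] with ω hω
    refine tendsto_const_nhds.congr' ?_
    filter_upwards [hω.def one_pos] with n hn
    rcases eq_or_ne (X n ω) 0 with h0 | h0
    · simp only [h0, norm_zero, mul_zero, norm_le_zero_iff, sub_zero] at hn
      simp [h0, hn]
    · simp [ρ, smul_smul, mul_inv_cancel₀ (norm_ne_zero_iff.2 h0)]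

lemma IsLocalMin.sum_gradient_eq_zero {ι κ : Type*} [Fintype ι] {s : Finset κ}
    {f : κ → EuclideanSpace ℝ ι → ℝ} {θ : EuclideanSpace ℝ ι}
    (hd : ∀ i ∈ s, DifferentiableAt ℝ (f i) θ) (hmin : IsLocalMin (fun t => ∑ i ∈ s, f i t) θ) :
    ∑ i ∈ s, gradient (f i) θ = 0 := by
  have h := hmin.hasFDerivAt_eq_zero (HasFDerivAt.fun_sum fun i hi => (hd i hi).hasFDerivAt)
  simp only [gradient, ← map_sum, h, map_zero]

variable {𝒵 ι : Type*} [MeasurableSpace 𝒵] [Fintype ι] {Z : ℕ → Ω → 𝒵}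
  {h : 𝒵 → EuclideanSpace ℝ ι → ℝ} {Θ : Set (EuclideanSpace ℝ ι)} {θs : EuclideanSpace ℝ ι} {M : ℝ}

/-- The expected contrast has an interior minimum at `θs`, and its derivative may be taken under the
integral: by the mean value inequality the gradient on a ball of radius `r` is dominated by
`‖∇h(θs)‖ + D * r`. -/
lemma integral_gradient_eq_zero (hZ : AEMeasurable (Z 0) P) (hθs : Θ ∈ 𝓝 θs)
    (hm : ∀ θ ∈ Θ, AEMeasurable (fun z => h z θ) (P.map (Z 0)))
    (hb : ∀ θ ∈ Θ, ∀ z, |h z θ| ≤ M)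
    (hd : ∀ᵐ z ∂(P.map (Z 0)), ∀ θ ∈ Θ, TwiceDifferentiableAt (h z) θ)
    (hmin : ∀ t ∈ Θ, t ≠ θs → ∫ ω, h (Z 0 ω) θs ∂P < ∫ ω, h (Z 0 ω) t ∂P)
    {D : Ω → ℝ} (hDi : Integrable D P)
    (hD : ∀ᵐ ω ∂P, ∀ θ ∈ Θ, ‖fderiv ℝ (gradient (h (Z 0 ω))) θ‖ ≤ D ω)
    (hL2 : MemLp (fun ω => gradient (h (Z 0 ω)) θs) 2 P) (t : EuclideanSpace ℝ ι) :
    ∫ ω, inner ℝ (gradient (h (Z 0 ω)) θs) t ∂P = 0 := by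
  obtain ⟨r, hr, hrΘ⟩ := Metric.mem_nhds_iff.1 hθs
  have hθsr := Metric.mem_ball_self (x := θs) hr
  have hdω := ae_of_ae_map hZ hd
  have hi := hL2.integrable one_le_two
  have hm' (θ) (hθ : θ ∈ Θ) : AEMeasurable (fun ω => h (Z 0 ω) θ) P := (hm θ hθ).comp_aemeasurable hZ
  have hfm : AEMeasurable (fun ω => fderiv ℝ (h (Z 0 ω)) θs) P :=
    (aemeasurable_fderiv_of_eventually (mem_of_superset hθs hm)
      (hd.mono fun z hz => (hz θs (mem_of_mem_nhds hθs)).differentiableAt)).comp_aemeasurable hZ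
  have hnorm (z θ) : ‖fderiv ℝ (h z) θ‖ = ‖gradient (h z) θ‖ := by
    simp [gradient]
  have hfi : Integrable (fun ω => fderiv ℝ (h (Z 0 ω)) θs) P :=
    hi.norm.mono' hfm.aestronglyMeasurable (Eventually.of_forall fun ω => (hnorm _ _).le)
  have hder : HasFDerivAt (fun θ => ∫ ω, h (Z 0 ω) θ ∂P)
      (∫ ω, fderiv ℝ (h (Z 0 ω)) θs ∂P) θs := by
    refine hasFDerivAt_integral_of_dominated_of_fderiv_le (s := Metric.ball θs r)
      (F' := fun θ ω => fderiv ℝ (h (Z 0 ω)) θ)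
      (bound := fun ω => ‖gradient (h (Z 0 ω)) θs‖ + D ω * r) (Metric.ball_mem_nhds _ hr)
      ?_ ?_ hfm.aestronglyMeasurable ?_ (hi.norm.add (hDi.mul_const r)) ?_
    · filter_upwards [hθs] with θ hθ using (hm' θ hθ).aestronglyMeasurable
    · exact Integrable.of_bound (hm' θs (mem_of_mem_nhds hθs)).aestronglyMeasurable M
        (Eventually.of_forall fun ω => hb θs (mem_of_mem_nhds hθs) _)
    · filter_upwards [hdω, hD] with ω h1 h2 θ hθ
      have := (convex_ball θs r).norm_image_sub_le_of_norm_fderiv_le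
        (fun y hy => (h1 y (hrΘ hy)).differentiableAt_gradient) (fun y hy => h2 y (hrΘ hy)) hθsr hθ
      have h3 : D ω * ‖θ - θs‖ ≤ D ω * r :=
        mul_le_mul_of_nonneg_left (mem_ball_iff_norm.1 hθ).le
          ((norm_nonneg _).trans (h2 θs (hrΘ hθsr)))
      rw [hnorm]
      linarith [norm_le_norm_add_norm_sub' (gradient (h (Z 0 ω)) θ) (gradient (h (Z 0 ω)) θs)]
    · filter_upwards [hdω] with ω h1 θ hθ using (h1 θ (hrΘ hθ)).differentiableAt.hasFDerivAt
  have hloc : IsLocalMin (fun θ => ∫ ω, h (Z 0 ω) θ ∂P) θs := by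
    filter_upwards [hθs] with θ hθ
    rcases eq_or_ne θ θs with rfl | hne
    · exact le_rfl
    · exact (hmin θ hθ hne).le
  have h0 := hloc.hasFDerivAt_eq_zero hder
  have h1 (ω) : inner ℝ (gradient (h (Z 0 ω)) θs) t = fderiv ℝ (h (Z 0 ω)) θs t := by
    simp [gradient]
  simp_rw [h1]
  rw [← ContinuousLinearMap.integral_apply hfi, h0, zero_apply]

/-- **Asymptotic normality** of minimizers of the empirical contrast of an i.i.d. sample. The
contrast is bounded and twice differentiable with an integrably dominated Hessian. -/
theorem tendstoInDistribution_minimizer [DecidableEq ι] (hind : iIndepFun Z P)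
    (hid : ∀ i, IdentDistrib (Z i) (Z 0) P P) (hΘ : IsCompact Θ) (hθs : Θ ∈ 𝓝 θs)
    (hm : ∀ θ ∈ Θ, AEMeasurable (fun z => h z θ) (P.map (Z 0)))
    (hb : ∀ θ ∈ Θ, ∀ z, |h z θ| ≤ M)
    (hd : ∀ᵐ z ∂(P.map (Z 0)), ∀ θ ∈ Θ, TwiceDifferentiableAt (h z) θ)
    (hmin : ∀ t ∈ Θ, t ≠ θs → ∫ ω, h (Z 0 ω) θs ∂P < ∫ ω, h (Z 0 ω) t ∂P)
    {D : Ω → ℝ} (hDi : Integrable D P)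
    (hD : ∀ᵐ ω ∂P, ∀ θ ∈ Θ, ‖fderiv ℝ (gradient (h (Z 0 ω))) θ‖ ≤ D ω)
    (hL2 : MemLp (fun ω => gradient (h (Z 0 ω)) θs) 2 P)
    {B : EuclideanSpace ℝ ι →L[ℝ] EuclideanSpace ℝ ι}
    (hB : B ∘L (∫ ω, fderiv ℝ (gradient (h (Z 0 ω))) θs ∂P) = ContinuousLinearMap.id ℝ _)
    {S : Matrix ι ι ℝ} (hS : S.PosSemidef)
    (hcov : ∀ t, ∫ ω, inner ℝ (B (gradient (h (Z 0 ω)) θs)) t ^ 2 ∂P = t ⬝ᵥ S.mulVec t)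
    {θhat : ℕ → Ω → EuclideanSpace ℝ ι} (hθm : ∀ n, AEMeasurable (θhat n) P)
    (hθhat : ∀ n, 1 ≤ n → ∀ᵐ ω ∂P, θhat n ω ∈ Θ ∧ ∀ θ ∈ Θ,
      ∑ i ∈ Finset.range n, h (Z i ω) (θhat n ω) ≤ ∑ i ∈ Finset.range n, h (Z i ω) θ) :
    TendstoInDistribution (fun (n : ℕ) ω => √(n : ℝ) • (θhat n ω - θs)) atTop
      (id : EuclideanSpace ℝ ι → EuclideanSpace ℝ ι) (fun _ => P) (multivariateGaussian 0 S) := by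
  set A : EuclideanSpace ℝ ι →L[ℝ] EuclideanSpace ℝ ι :=
    ∫ ω, fderiv ℝ (gradient (h (Z 0 ω))) θs ∂P with hA
  have hZ : AEMeasurable (Z 0) P := (hid 0).aemeasurable_fst
  have hθsΘ := mem_of_mem_nhds hθs
  obtain ⟨r, hr, hrΘ⟩ := Metric.mem_nhds_iff.1 hθs
  have hdω := ae_of_ae_map hZ hd
  have hgm (θ) (hθ : Θ ∈ 𝓝 θ) :
      AEMeasurable (fun z => gradient (h z) θ) (P.map (Z 0)) :=
    aemeasurable_gradient_of_eventually (mem_of_superset hθ hm)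
      (hd.mono fun z hz => (hz θ (mem_of_mem_nhds hθ)).differentiableAt)
  have hgd : ∀ᵐ z ∂(P.map (Z 0)), ∀ θ ∈ Metric.ball θs r, DifferentiableAt ℝ (gradient (h z)) θ :=
    hd.mono fun z hz θ hθ => (hz θ (hrΘ hθ)).differentiableAt_gradient
  have hAm : AEMeasurable (fun z => fderiv ℝ (gradient (h z)) θs) (P.map (Z 0)) := by
    refine aemeasurable_fderiv_of_eventually ?_ (hd.mono fun z hz =>
      (hz θs hθsΘ).differentiableAt_gradient)
    filter_upwards [eventually_mem_nhds_iff.2 hθs] with θ hθ using hgm θ hθ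
  have hAi : Integrable (fun ω => fderiv ℝ (gradient (h (Z 0 ω))) θs) P :=
    hDi.mono' (hAm.comp_aemeasurable hZ).aestronglyMeasurable
      (hD.mono fun ω hω => hω θs hθsΘ)
  have hcons := ae_tendsto_of_minimizer hind hid hΘ hm hb
    (hd.mono fun z hz θ hθ => (hz θ hθ).differentiableAt.continuousAt.continuousWithinAt) hθsΘ hmin
    (θhat := θhat) fun n hn => (hθhat n hn).mono fun ω hω => ⟨hω.1, hω.2 θs hθsΘ⟩
  have hhat : ∀ᵐ ω ∂P, ∀ n, 1 ≤ n → θhat n ω ∈ Θ ∧ ∀ θ ∈ Θ,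
      ∑ i ∈ Finset.range n, h (Z i ω) (θhat n ω) ≤ ∑ i ∈ Finset.range n, h (Z i ω) θ :=
    ae_all_iff.2 fun n => by
      by_cases hn : 1 ≤ n
      · filter_upwards [hθhat n hn] with ω hω using fun _ => hω
      · exact Eventually.of_forall fun ω h => absurd h hn
  have hlin := ae_average_linearizationError_isLittleO (s := fun z => gradient (h z)) (x := θs)
    hind hid hr
    (fun θ hθ => hgm θ (mem_of_superset (Metric.isOpen_ball.mem_nhds hθ) hrΘ)) hAm hgd hDi
    (hD.mono fun ω hω θ hθ => hω θ (hrΘ hθ))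
  -- The influence function: `-A⁻¹` applied to the score, `B` being a left inverse of the expected
  -- Hessian `A`.
  let ξ (z : 𝒵) : EuclideanSpace ℝ ι := -B (gradient (h z) θs)
  have hξm : AEMeasurable ξ (P.map (Z 0)) :=
    (B.continuous.measurable.comp_aemeasurable (hgm θs hθs)).neg
  have hξm' (i : ℕ) : AEMeasurable ξ (P.map (Z i)) := (hid i).map_eq ▸ hξm
  have hinner (ω t) : inner ℝ (ξ (Z 0 ω)) t =
      -inner ℝ (gradient (h (Z 0 ω)) θs) (B.adjoint t) := by
    simp only [ξ, inner_neg_left, ContinuousLinearMap.adjoint_inner_right]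
  have hclt := tendstoInDistribution_inv_sqrt_smul_sum (P := P) (X := fun i ω => ξ (Z i ω)) hS
    (fun t => ((B.comp_memLp' hL2).neg).inner_const t)
    (fun t => by
      simp_rw [hinner, integral_neg]
      rw [integral_gradient_eq_zero hZ hθs hm hb hd hmin hDi hD hL2, neg_zero])
    (fun t => by simpa only [ξ, inner_neg_left, neg_sq] using hcov t)
    (hind.comp₀ (fun _ => ξ) (fun i => (hid i).aemeasurable_fst) hξm')
    (fun i => (hid i).comp_of_aemeasurable (hξm' i))
  refine hclt.of_sub_isLittleO (fun n => by have := hθm n; fun_prop) ?_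
  filter_upwards [hcons, hhat, hlin, ae_tendsto_average hind hid hAm hAi,
    ae_forall_of_ae_map hid hd] with ω h1 h2 h3 h4 h5
  have hR := h3 _ h1
  -- Consistency puts the estimator in the interior of `Θ` eventually, so its minimality over `Θ` is
  -- a local minimum.
  have hfoc : ∀ᶠ n in atTop, ∑ i ∈ Finset.range n, gradient (h (Z i ω)) (θhat n ω) = 0 := by
    filter_upwards [h1.eventually (eventually_mem_nhds_iff.2 hθs), eventually_ge_atTop 1]
      with n hn hn1
    refine IsLocalMin.sum_gradient_eq_zero
      (fun i _ => (h5 i _ (h2 n hn1).1).differentiableAt) ?_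
    filter_upwards [hn] with θ hθ using (h2 n hn1).2 θ hθ
  have hAn : (fun n : ℕ => ((n : ℝ)⁻¹ • ∑ i ∈ Finset.range n, fderiv ℝ (gradient (h (Z i ω))) θs - A)
      (θhat n ω - θs)) =o[atTop] fun n => θhat n ω - θs := by
    refine Asymptotics.isLittleO_iff.2 fun c hc => ?_
    filter_upwards [(tendsto_iff_norm_sub_tendsto_zero.1 h4).eventually_le_const hc] with n hn
    exact ContinuousLinearMap.le_of_opNorm_le _ hn _
  -- Once the score sum at `θhat` vanishes, the averaged linearization error plus `(A_n - A) (θhat -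
  -- θs)` equals `-(mean score at θs) - A (θhat - θs)`, where `A_n` is the mean Hessian at `θs`.
  -- Applying `B` gives the left side exactly.
  have hx : (fun n : ℕ => (n : ℝ)⁻¹ • ∑ i ∈ Finset.range n, ξ (Z i ω) - (θhat n ω - θs))
      =o[atTop] fun n => θhat n ω - θs := by
    refine ((B.isBigO_comp _ _).trans_isLittleO (hR.add hAn)).congr' ?_ EventuallyEq.rfl
    filter_upwards [hfoc] with n hn
    have hBA : B (A (θhat n ω - θs)) = θhat n ω - θs := by
      simpa using congrArg (fun L => L (θhat n ω - θs)) hB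
    simp only [linearizationError, Finset.sum_sub_distrib, hn, ξ, Finset.sum_neg_distrib, ← map_sum,
      sub_apply, smul_apply, sum_apply, map_add, map_sub, map_smul, smul_sub, smul_neg, map_zero,
      smul_zero]
    simp only [map_sub] at hBA
    rw [← hBA]
    abel
  -- Symmetry of asymptotic equivalence replaces the unknown scale `θhat - θs` of the error by that
  -- of the averaged influence functions.
  have hy := (Asymptotics.IsEquivalent.symm hx).isLittleO
  have hsqrt (n : ℕ) : (√(n : ℝ))⁻¹ = √(n : ℝ) * (n : ℝ)⁻¹ := by
    rw [← Real.sqrt_div_self, div_eq_mul_inv]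
  refine ((Asymptotics.isBigO_refl (fun n : ℕ => √(n : ℝ)) atTop).smul_isLittleO hy).congr
    (fun n => ?_) fun n => ?_
  · rw [Pi.sub_apply, smul_sub, smul_smul, hsqrt]
  · rw [smul_smul, hsqrt]

end AsymptoticNormality

/-! ### Partial derivatives, gradients and Hessian matrices -/

section Coordinates

variable {ι : Type*} [Fintype ι] [DecidableEq ι] {F : EuclideanSpace ℝ ι → ℝ}
  {θ : EuclideanSpace ℝ ι}

lemma gradient_apply_eq_partialDeriv (F : EuclideanSpace ℝ ι → ℝ) (θ : EuclideanSpace ℝ ι) (i : ι) :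
    gradient F θ i = partialDeriv i F θ := by
  have : inner ℝ (gradient F θ) (EuclideanSpace.single i (1 : ℝ)) = partialDeriv i F θ := by
    simp [gradient, partialDeriv]
  rwa [EuclideanSpace.inner_single_right, one_mul, conj_trivial] at this

lemma TwiceDifferentiableAt.fderiv_gradient_single (hF : TwiceDifferentiableAt F θ) (i j : ι) :
    fderiv ℝ (gradient F) θ (EuclideanSpace.single i 1) j = hessianMatrix F θ i j := by
  have h1 : partialDeriv j F = fun t => EuclideanSpace.proj (𝕜 := ℝ) j (gradient F t) := by
    ext t
    simp [gradient_apply_eq_partialDeriv]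
  have h2 : HasFDerivAt (partialDeriv j F)
      ((EuclideanSpace.proj (𝕜 := ℝ) j).comp (fderiv ℝ (gradient F) θ)) θ := by
    rw [h1]
    exact (EuclideanSpace.proj (𝕜 := ℝ) j).hasFDerivAt.comp θ
      hF.differentiableAt_gradient.hasFDerivAt
  simp only [hessianMatrix, Matrix.of_apply]
  rw [partialDeriv, h2.fderiv]
  simp

lemma EuclideanSpace.norm_le_sum_abs (v : EuclideanSpace ℝ ι) : ‖v‖ ≤ ∑ j, |v j| := by
  conv_lhs => rw [← (EuclideanSpace.basisFun ι ℝ).sum_repr v]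
  refine (norm_sum_le _ _).trans (Finset.sum_le_sum fun j _ => ?_)
  simp [norm_smul]

lemma TwiceDifferentiableAt.norm_fderiv_gradient_le (hF : TwiceDifferentiableAt F θ) :
    ‖fderiv ℝ (gradient F) θ‖ ≤ matrixL1Norm (hessianMatrix F θ) := by
  have h0 : 0 ≤ matrixL1Norm (hessianMatrix F θ) :=
    Finset.sum_nonneg fun i _ => Finset.sum_nonneg fun j _ => abs_nonneg _
  refine ContinuousLinearMap.opNorm_le_bound _ h0 fun x => ?_
  conv_lhs => rw [← (EuclideanSpace.basisFun ι ℝ).sum_repr x, map_sum]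
  rw [matrixL1Norm, Finset.sum_mul]
  refine (norm_sum_le _ _).trans (Finset.sum_le_sum fun i _ => ?_)
  rw [map_smul, norm_smul, mul_comm]
  refine mul_le_mul ?_ ?_ (norm_nonneg _) (Finset.sum_nonneg fun j _ => abs_nonneg _)
  · simp only [← hF.fderiv_gradient_single, EuclideanSpace.basisFun_apply]
    exact EuclideanSpace.norm_le_sum_abs _
  · simpa using PiLp.norm_apply_le x i

lemma norm_fderiv_gradient_le_toReal_iSup {Θ : Set (EuclideanSpace ℝ ι)}
    (hF : ∀ θ ∈ Θ, TwiceDifferentiableAt F θ)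
    (hfin : ⨆ θ ∈ Θ, ENNReal.ofReal (matrixL1Norm (hessianMatrix F θ)) < ∞) (hθ : θ ∈ Θ) :
    ‖fderiv ℝ (gradient F) θ‖ ≤
      (⨆ θ ∈ Θ, ENNReal.ofReal (matrixL1Norm (hessianMatrix F θ))).toReal := by
  rw [← ENNReal.ofReal_le_iff_le_toReal hfin.ne]
  exact (ENNReal.ofReal_le_ofReal (hF θ hθ).norm_fderiv_gradient_le).trans
    (le_iSup₂ (f := fun θ (_ : θ ∈ Θ) => ENNReal.ofReal (matrixL1Norm (hessianMatrix F θ))) θ hθ)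

end Coordinates

/-! ### Expected Hessian and score covariance as matrices -/

section MatrixForm

variable {Ω ι : Type*} [MeasurableSpace Ω] {P : Measure Ω} [Fintype ι] [DecidableEq ι]
  {F : Ω → EuclideanSpace ℝ ι → ℝ} {θ : EuclideanSpace ℝ ι}

/-- The transpose appears because the derivative of the gradient in direction `i` has `j`-th
coordinate `∂_i ∂_j F`, that is, `i` indexes the column; symmetry of second derivatives is not
invoked. -/
lemma integral_fderiv_gradient_eq_toEuclideanCLM
    (hF : ∀ᵐ ω ∂P, TwiceDifferentiableAt (F ω) θ)
    (hi : Integrable (fun ω => fderiv ℝ (gradient (F ω)) θ) P) :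
    ∫ ω, fderiv ℝ (gradient (F ω)) θ ∂P =
      Matrix.toEuclideanCLM (n := ι) (𝕜 := ℝ) (expectedHessian P F θ).transpose := by
  ext1 x
  rw [← (EuclideanSpace.basisFun ι ℝ).sum_repr x, map_sum, map_sum]
  refine Finset.sum_congr rfl fun i _ => ?_
  rw [map_smul, map_smul, EuclideanSpace.basisFun_apply, ContinuousLinearMap.integral_apply hi]
  congr 1
  ext j
  have h1 := (EuclideanSpace.proj (𝕜 := ℝ) j).integral_comp_comm
    (hi.apply_continuousLinearMap (EuclideanSpace.single i 1))
  simp only [EuclideanSpace.coe_proj] at h1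
  rw [← h1, Matrix.ofLp_toEuclideanCLM]
  simp only [PiLp.single, Matrix.mulVec_single_one, Matrix.col_transpose, Matrix.row_apply,
    expectedHessian, Matrix.of_apply]
  exact integral_congr_ae (hF.mono fun ω hω => hω.fderiv_gradient_single i j)

lemma integral_inner_gradient_sq
    (hK : ∀ i j, Integrable (fun ω => partialDeriv i (F ω) θ * partialDeriv j (F ω) θ) P)
    (u : EuclideanSpace ℝ ι) :
    ∫ ω, inner ℝ (gradient (F ω) θ) u ^ 2 ∂P = u ⬝ᵥ (expectedScoreOuter P F θ).mulVec u := by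
  have h1 (ω) : inner ℝ (gradient (F ω) θ) u ^ 2 =
      ∑ i, ∑ j, u i * (partialDeriv i (F ω) θ * partialDeriv j (F ω) θ * u j) := by
    simp only [PiLp.inner_apply, gradient_apply_eq_partialDeriv, RCLike.inner_apply, conj_trivial,
      sq, Finset.sum_mul_sum]
    refine Finset.sum_congr rfl fun i _ => Finset.sum_congr rfl fun j _ => ?_
    ring
  simp_rw [h1]
  rw [integral_finsetSum _ fun i _ => integrable_finsetSum _ fun j _ =>
    ((hK i j).mul_const _).const_mul _]
  simp only [dotProduct, Matrix.mulVec, Finset.mul_sum]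
  refine Finset.sum_congr rfl fun i _ => ?_
  rw [integral_finsetSum _ fun j _ => ((hK i j).mul_const _).const_mul _]
  refine Finset.sum_congr rfl fun j _ => ?_
  rw [integral_const_mul, integral_mul_const]
  rfl

lemma posSemidef_expectedScoreOuter
    (hK : ∀ i j, Integrable (fun ω => partialDeriv i (F ω) θ * partialDeriv j (F ω) θ) P) :
    (expectedScoreOuter P F θ).PosSemidef := by
  refine Matrix.PosSemidef.of_dotProduct_mulVec_nonneg ?_ fun x => ?_
  · ext i j
    simp [expectedScoreOuter, mul_comm]
  · have := integral_inner_gradient_sq hK (WithLp.toLp 2 x)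
    rw [star_trivial, ← this]
    exact integral_nonneg fun ω => sq_nonneg _

end MatrixForm

/-! ### The sandwich covariance -/

section Sandwich

variable {Ω 𝒵 ι : Type*} [MeasurableSpace Ω] {P : Measure Ω} [IsProbabilityMeasure P]
  [MeasurableSpace 𝒵] [Fintype ι] [DecidableEq ι] {Z : ℕ → Ω → 𝒵}
  {h : 𝒵 → EuclideanSpace ℝ ι → ℝ} {Θ : Set (EuclideanSpace ℝ ι)} {θs : EuclideanSpace ℝ ι} {M : ℝ}

/-- Asymptotic normality of minimum contrast estimators, with the sandwich covariance matrix. -/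
theorem tendstoInDistribution_minimizer_sandwich (hind : iIndepFun Z P)
    (hid : ∀ i, IdentDistrib (Z i) (Z 0) P P) (hΘ : IsCompact Θ) (hθs : Θ ∈ 𝓝 θs)
    (hm : ∀ θ ∈ Θ, AEMeasurable (fun z => h z θ) (P.map (Z 0)))
    (hb : ∀ θ ∈ Θ, ∀ z, |h z θ| ≤ M)
    (hd : ∀ᵐ z ∂(P.map (Z 0)), ∀ θ ∈ Θ, TwiceDifferentiableAt (h z) θ)
    (hmin : ∀ t ∈ Θ, t ≠ θs → ∫ ω, h (Z 0 ω) θs ∂P < ∫ ω, h (Z 0 ω) t ∂P)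
    (hK : ∀ i j, Integrable (fun ω =>
      partialDeriv i (h (Z 0 ω)) θs * partialDeriv j (h (Z 0 ω)) θs) P)
    (hsup_meas : AEMeasurable
      (fun ω => ⨆ θ ∈ Θ, ENNReal.ofReal (matrixL1Norm (hessianMatrix (h (Z 0 ω)) θ))) P)
    (hsup : ∫⁻ ω, (⨆ θ ∈ Θ, ENNReal.ofReal (matrixL1Norm (hessianMatrix (h (Z 0 ω)) θ))) ∂P < ∞)
    (hJ : (expectedHessian P (fun ω => h (Z 0 ω)) θs).PosDef)
    {θhat : ℕ → Ω → EuclideanSpace ℝ ι} (hθm : ∀ n, AEMeasurable (θhat n) P)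
    (hθhat : ∀ n, 1 ≤ n → ∀ᵐ ω ∂P, θhat n ω ∈ Θ ∧ ∀ θ ∈ Θ,
      ∑ i ∈ Finset.range n, h (Z i ω) (θhat n ω) ≤ ∑ i ∈ Finset.range n, h (Z i ω) θ) :
    TendstoInDistribution (fun (n : ℕ) ω => √(n : ℝ) • (θhat n ω - θs)) atTop
      (id : EuclideanSpace ℝ ι → EuclideanSpace ℝ ι) (fun _ => P)
      (multivariateGaussian 0 ((expectedHessian P (fun ω => h (Z 0 ω)) θs)⁻¹ *
        expectedScoreOuter P (fun ω => h (Z 0 ω)) θs *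
        (expectedHessian P (fun ω => h (Z 0 ω)) θs)⁻¹)) := by
  set J := expectedHessian P (fun ω => h (Z 0 ω)) θs
  set K := expectedScoreOuter P (fun ω => h (Z 0 ω)) θs
  have hZ : AEMeasurable (Z 0) P := (hid 0).aemeasurable_fst
  have hθsΘ := mem_of_mem_nhds hθs
  have hdω := ae_of_ae_map hZ hd
  have hD : ∀ᵐ ω ∂P, ∀ θ ∈ Θ, ‖fderiv ℝ (gradient (h (Z 0 ω))) θ‖ ≤
      (⨆ θ ∈ Θ, ENNReal.ofReal (matrixL1Norm (hessianMatrix (h (Z 0 ω)) θ))).toReal := by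
    filter_upwards [hdω, ae_lt_top' hsup_meas hsup.ne] with ω h1 h2 θ hθ
    exact norm_fderiv_gradient_le_toReal_iSup h1 h2 hθ
  have hDi := integrable_toReal_of_lintegral_ne_top hsup_meas hsup.ne
  have hgm (θ) (hθ : Θ ∈ 𝓝 θ) :
      AEMeasurable (fun z => gradient (h z) θ) (P.map (Z 0)) :=
    aemeasurable_gradient_of_eventually (mem_of_superset hθ hm)
      (hd.mono fun z hz => (hz θ (mem_of_mem_nhds hθ)).differentiableAt)
  have hAm : AEMeasurable (fun z => fderiv ℝ (gradient (h z)) θs) (P.map (Z 0)) := by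
    refine aemeasurable_fderiv_of_eventually ?_ (hd.mono fun z hz =>
      (hz θs hθsΘ).differentiableAt_gradient)
    filter_upwards [eventually_mem_nhds_iff.2 hθs] with θ hθ using hgm θ hθ
  have hAi : Integrable (fun ω => fderiv ℝ (gradient (h (Z 0 ω))) θs) P :=
    hDi.mono' (hAm.comp_aemeasurable hZ).aestronglyMeasurable (hD.mono fun ω hω => hω θs hθsΘ)
  have hg0 : AEMeasurable (fun ω => gradient (h (Z 0 ω)) θs) P := (hgm θs hθs).comp_aemeasurable hZ
  -- Square integrability of the score is the integrability of the diagonal products in `K`.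
  have hL2 : MemLp (fun ω => gradient (h (Z 0 ω)) θs) 2 P := by
    refine MemLp.of_eval_piLp fun i => ?_
    have hi : AEMeasurable (fun ω => gradient (h (Z 0 ω)) θs i) P :=
      (EuclideanSpace.proj (𝕜 := ℝ) i).continuous.measurable.comp_aemeasurable hg0
    rw [memLp_two_iff_integrable_sq hi.aestronglyMeasurable]
    simpa only [gradient_apply_eq_partialDeriv, sq] using hK i i
  -- Symmetry of `J` is part of its positive definiteness.
  have hJt : J.transpose = J := by
    have := hJ.isHermitian.eq
    rwa [Matrix.conjTranspose_eq_transpose_of_trivial] at this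
  have hJi : J⁻¹.transpose = J⁻¹ := by rw [Matrix.transpose_nonsing_inv, hJt]
  have hB : Matrix.toEuclideanCLM (n := ι) (𝕜 := ℝ) J⁻¹ ∘L
      (∫ ω, fderiv ℝ (gradient (h (Z 0 ω))) θs ∂P) = ContinuousLinearMap.id ℝ _ := by
    rw [integral_fderiv_gradient_eq_toEuclideanCLM (hdω.mono fun ω hω => hω θs hθsΘ) hAi]
    change Matrix.toEuclideanCLM (n := ι) (𝕜 := ℝ) J⁻¹ *
      Matrix.toEuclideanCLM (n := ι) (𝕜 := ℝ) J.transpose = 1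
    rw [hJt, ← map_mul, Matrix.nonsing_inv_mul _ ((Matrix.isUnit_iff_isUnit_det _).1 hJ.isUnit),
      map_one]
  have hS : (J⁻¹ * K * J⁻¹).PosSemidef := by
    have := (posSemidef_expectedScoreOuter hK).conjTranspose_mul_mul_same J⁻¹
    rwa [Matrix.conjTranspose_eq_transpose_of_trivial, hJi] at this
  refine tendstoInDistribution_minimizer hind hid hΘ hθs hm hb hd hmin hDi hD hL2 hB hS
    (fun t => ?_) hθm hθhat
  -- `J⁻¹` is self-adjoint, so it moves onto `t`, and the second moment becomes the quadratic form
  -- of `K` at `J⁻¹ t`.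
  have hin (ω) : inner ℝ (Matrix.toEuclideanCLM (n := ι) (𝕜 := ℝ) J⁻¹ (gradient (h (Z 0 ω)) θs)) t =
      inner ℝ (gradient (h (Z 0 ω)) θs) (Matrix.toEuclideanCLM (n := ι) (𝕜 := ℝ) J⁻¹ t) := by
    rw [real_inner_comm, Matrix.inner_toEuclideanCLM, Matrix.inner_toEuclideanCLM,
      Matrix.dotProduct_mulVec, dotProduct_comm, ← Matrix.mulVec_transpose, hJi]
  simp_rw [hin]
  rw [integral_inner_gradient_sq hK, Matrix.ofLp_toEuclideanCLM, ← Matrix.mulVec_mulVec,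
    ← Matrix.mulVec_mulVec, Matrix.dotProduct_mulVec t.ofLp J⁻¹, ← Matrix.mulVec_transpose, hJi]

end Sandwich

/-! ### Application to the stochastic frontier model -/

theorem theorem2 {Ω : Type*} [MeasurableSpace Ω] (P : Measure Ω) [IsProbabilityMeasure P]
    {p q k : ℕ}
    -- the true model and the sample
    (g : EuclideanSpace ℝ (Fin p) → EuclideanSpace ℝ (Fin q) → ℝ)
    (hg_meas : ∀ β, Measurable fun x => g x β)
    (hg_cont : ∀ x, Continuous (g x))
    (β₀ : EuclideanSpace ℝ (Fin q))
    (fX : EuclideanSpace ℝ (Fin p) → ℝ) (fV fU : ℝ → ℝ)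
    (X : ℕ → Ω → EuclideanSpace ℝ (Fin p)) (V U Y : ℕ → Ω → ℝ)
    (hsample : IsFrontierSample P g β₀ fX fV fU X V U Y)
    -- the compact parameter space and the pseudo distributions
    (Θ : Set (ParamSpace q k)) (hΘ : IsCompact Θ)
    (ψV ψU : EuclideanSpace ℝ (Fin k) → ℝ → ℝ)
    (hψV : ∀ θ ∈ Θ, IsProbDensity (ψV θ.eta))
    (hψU : ∀ θ ∈ Θ, IsProbDensity (ψU θ.eta) ∧ ∀ u < 0, ψU θ.eta u = 0)
    (C : ℝ) (hC : ∀ θ ∈ Θ, ∀ x y, pseudoDensity g ψV ψU θ x y ≤ C)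
    -- the pseudo true parameter
    (α : ℝ) (hα : 0 < α)
    (θs : ParamSpace q k)
    (hθs : IsUniqueMinimizer
      (fun θ => ∫⁻ ω, densityPowerDivergence α
        (frontierDensity fV fU (g (X 0 ω) β₀)) (pseudoDensity g ψV ψU θ (X 0 ω)) ∂P) Θ θs)
    (hθs_int : θs ∈ interior Θ)
    -- the random function `θ ↦ H_α(X, Y; θ)` and its derivatives
    (H : ℕ → Ω → ParamSpace q k → ℝ)
    (hH : ∀ i ω, H i ω = objective α (pseudoDensity g ψV ψU) (X i ω) (Y i ω))
    (hdiff : ∀ᵐ z ∂(P.map fun ω => (X 0 ω, Y 0 ω)), ∀ θ ∈ Θ,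
      TwiceDifferentiableAt (objective α (pseudoDensity g ψV ψU) z.1 z.2) θ)
    (hK : ∀ i j, Integrable (fun ω => partialDeriv i (H 0 ω) θs * partialDeriv j (H 0 ω) θs) P)
    (hsup_meas : AEMeasurable
      (fun ω => ⨆ θ ∈ Θ, ENNReal.ofReal (matrixL1Norm (hessianMatrix (H 0 ω) θ))) P)
    (hsup : ∫⁻ ω, (⨆ θ ∈ Θ, ENNReal.ofReal (matrixL1Norm (hessianMatrix (H 0 ω) θ))) ∂P < ∞)
    (hJ : (expectedHessian P (H 0) θs).PosDef)
    -- the estimator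
    (θhat : ℕ → Ω → ParamSpace q k)
    (hθhat_meas : ∀ n, AEMeasurable (θhat n) P)
    (hθhat : ∀ n, 1 ≤ n → ∀ᵐ ω ∂P, θhat n ω ∈ Θ ∧
      ∀ θ ∈ Θ, (1 / (n : ℝ)) * ∑ i ∈ Finset.range n, H i ω (θhat n ω)
        ≤ (1 / (n : ℝ)) * ∑ i ∈ Finset.range n, H i ω θ) :
    TendstoInDistribution (fun (n : ℕ) ω => √(n : ℝ) • (θhat n ω - θs)) atTop
      (id : ParamSpace q k → ParamSpace q k) (fun _ => P)
      (multivariateGaussian 0 ((expectedHessian P (H 0) θs)⁻¹ *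
        expectedScoreOuter P (H 0) θs * (expectedHessian P (H 0) θs)⁻¹)) := by
  have hg := hg_meas β₀
  obtain rfl : H = fun i ω => objective α (pseudoDensity g ψV ψU) (X i ω) (Y i ω) := by
    funext i ω
    exact hH i ω
  have hfm (θ) (hθ : θ ∈ Θ) : Measurable fun z : EuclideanSpace ℝ (Fin p) × ℝ =>
      pseudoDensity g ψV ψU θ z.1 z.2 :=
    measurable_frontierDensity_comp (hψV θ hθ).measurable (hψU θ hθ).1.measurable (hg_meas _)
  have hf0 (θ) (hθ : θ ∈ Θ) (x y) : 0 ≤ pseudoDensity g ψV ψU θ x y :=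
    frontierDensity_nonneg (hψV θ hθ).nonneg (hψU θ hθ).1.nonneg _ _
  have hf1 (θ) (hθ : θ ∈ Θ) (x) : ∫⁻ y, ENNReal.ofReal (pseudoDensity g ψV ψU θ x y) ≤ 1 :=
    lintegral_frontierDensity_le_one (hψV θ hθ) (hψU θ hθ).1 _
  -- The bound `M` adds `C ^ α` for the integral of `f_θ^(1+α)`, where the total mass is at most 1,
  -- and `(1 + 1/α) * C ^ α` for the second term.
  refine tendstoInDistribution_minimizer_sandwich
    (Z := fun i ω => (X i ω, Y i ω)) (M := (2 + 1 / α) * C ^ α)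
    (h := fun z => objective α (pseudoDensity g ψV ψU) z.1 z.2)
    (hsample.iIndepFun_pair hg) (hsample.identDistrib_pair hg) hΘ
    (mem_interior_iff_mem_nhds.1 hθs_int)
    (fun θ hθ => (measurable_objective (hfm θ hθ)).aemeasurable)
    (fun θ hθ z => abs_objective_le hα (hf0 θ hθ) (hC θ hθ) (hf1 θ hθ) _ _) hdiff
    (fun t ht hne => ?_) hK hsup_meas hsup hJ hθhat_meas (fun n hn => ?_)
  · have hmem : ∀ θ ∈ ({θs, t} : Set (ParamSpace q k)), θ ∈ Θ := by
      rintro θ (rfl | rfl)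
      exacts [hθs.1, ht]
    exact hsample.integral_objective_lt hg hα (fun θ hθ => hfm θ (hmem θ hθ))
      (fun θ hθ => hf0 θ (hmem θ hθ)) (fun θ hθ => hC θ (hmem θ hθ))
      (fun θ hθ => hf1 θ (hmem θ hθ)) (hθs.2 t ht hne)
  · have hn0 : (0 : ℝ) < 1 / n := by positivity
    filter_upwards [hθhat n hn] with ω hω
    exact ⟨hω.1, fun θ hθ => le_of_mul_le_mul_left (hω.2 θ hθ) hn0⟩
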